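/- Let $d\ge 0$, $\Xi=\mathbb R^d\times(\mathbb R^d)^*$, and write $X=(x,\xi)$, $Y=(y,\eta)$, $Z=(z,\zeta)\in\Xi$. Put $\sigma(X,Y)=\xi\cdot y-x\cdot\eta$ and $(\mathcal F_\sigma f)(X)=(2\pi)^{-d}\int_\Xi e^{i\sigma(X,X')}f(X')\,dX'$. Let $B$ be a polynomially bounded magnetic field on $\mathbb R^d$, i.e. a closed $2$-form whose components $B_{lj}$ are smooth functions all of whose derivatives are polynomially bounded. A polynomially bounded vector potential of $B$ is a $1$-form $A$ with $dA=B$ (that is, $B_{lj}=\partial_lA_j-\partial_jA_l$) whose components are of the same kind; such $A$ exist. For such an $A$ let $Q$ denote multiplication by $x$ and $P^A=-i\nabla-A(Q)$ on $L^2(\mathbb R^d)$; let $W^A(X)=e^{-i\sigma(X,(Q,P^A))}=e^{-i(\xi\cdot Q-x\cdot P^A)}$ be the magnetic Weyl system of unitary operators, and for $h\in\mathcal S(\Xi)$ let $\mathrm{Op}^A(h)=(2\pi)^{-d}\int_\Xi(\mathcal F_\sigma h)(X)\,W^A(X)\,dX$, an operator on $L^2(\mathbb R^d)$. For $a,b,c\in\mathbb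 R^d$ let $\omega^B(a,b,c)=\exp\bigl(-i\int_{\langle a,b,c\rangle}B\bigr)$, where $\langle a,b,c\rangle$ is the oriented triangle with corners $a,b,c$. Then for all $f,g\in\mathcal S(\Xi)$ there is a Schwartz function $f\sharp^Bg\in\mathcal S(\Xi)$, depending only on $B,f,g$, which for every polynomially bounded vector potential $A$ of $B$ is the unique element of $\mathcal S(\Xi)$ with $$\mathrm{Op}^A(f)\,\mathrm{Op}^A(g)=\mathrm{Op}^A(f\sharp^Bg).$$ For every $X\in\Xi$ it is given by the two absolutely convergent integrals $$(f\sharp^Bg)(X)=\frac1{(2\pi)^{2d}}\int_\Xi dY\int_\Xi dZ\;e^{i\sigma(X,Y+Z)}\,e^{\frac i2\sigma(Y,Z)}\;\omega^B\bigl(x-\tfrac12(y+z),\,x+\tfrac12(y-z),\,x+\tfrac12(y+z)\bigr)\,(\mathcal F_\sigma f)(Y)\,(\mathcal F_\sigma g)(Z)$$ $$=\frac1{\pi^{2d}}\int_\Xi dY\int_\Xi dZ\;e^{-2i\sigma(Y-X,Z-X)}\;\omega^B\bigl(x+y-z,\,-x+y+z,\,x-y+z\bigr)\,f(Y)\,g(Z).$$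 -/

import Mathlib

open MeasureTheory Complex
open scoped SchwartzMap

noncomputable section

namespace MagneticWeyl

/-- Configuration space `ℝ^d` with its Euclidean structure and Lebesgue measure. -/
abbrev Conf (d : ℕ) : Type := EuclideanSpace ℝ (Fin d)

/-- Phase space `Ξ = ℝ^d × (ℝ^d)^*`; a point `X = (x, ξ)` has position `X.1` and momentum `X.2`. -/
abbrev Phase (d : ℕ) : Type := Conf d × Conf d

/-- The Hilbert space `L²(ℝ^d)`. -/
abbrev L2 (d : ℕ) : Type := Lp ℂ 2 (volume : Measure (Conf d))

/-- The partial derivative `∂_l φ` at `x`. -/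
def partialDeriv {d : ℕ} (l : Fin d) (φ : Conf d → ℝ) (x : Conf d) : ℝ :=
  fderiv ℝ φ x (EuclideanSpace.single l 1)

/-- `B = ½ ∑ B_{lj} dx_l ∧ dx_j` is a magnetic field (a closed 2-form on `ℝ^d`) whose components
are smooth, each derivative being polynomially bounded. -/
structure IsPolMagneticField {d : ℕ} (B : Fin d → Fin d → Conf d → ℝ) : Prop where
  pol : ∀ l j, (B l j).HasTemperateGrowth
  antisymm : ∀ l j x, B j l x = -B l j x
  closed : ∀ k l j x,
    partialDeriv k (B l j) x + partialDeriv l (B j k) x + partialDeriv j (B k l) x = 0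

/-- `A = ∑ A_j dx_j` is a vector potential of `B` (that is `dA = B`) whose components are smooth,
each derivative being polynomially bounded. -/
structure IsPolVectorPotential {d : ℕ} (B : Fin d → Fin d → Conf d → ℝ)
    (A : Fin d → Conf d → ℝ) : Prop where
  pol : ∀ j, (A j).HasTemperateGrowth
  ext_deriv : ∀ l j x, B l j x = partialDeriv l (A j) x - partialDeriv j (A l) x

/-- The symplectic form `σ(X, Y) = ξ · y - x · η`. -/
def sigma {d : ℕ} (X Y : Phase d) : ℝ := inner ℝ X.2 Y.1 - inner ℝ X.1 Y.2

/-- The symplectic Fourier transform `(2π)^{-d} ∫ e^{iσ(X,X')} f(X') dX'`. -/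
def symplecticFourier {d : ℕ} (f : Phase d → ℂ) (X : Phase d) : ℂ :=
  ((2 * Real.pi : ℝ) : ℂ)⁻¹ ^ d * ∫ X' : Phase d, exp (I * (sigma X X' : ℂ)) * f X'

/-- The magnetic flux `∫ B` through the oriented triangle with corners `a`, `b`, `c`, parametrized
by `(s, t) ↦ a + s (b - a) + t (c - a)` with `0 ≤ s`, `0 ≤ t`, `s + t ≤ 1`. -/
def flux {d : ℕ} (B : Fin d → Fin d → Conf d → ℝ) (a b c : Conf d) : ℝ :=
  ∫ s in (0 : ℝ)..1, ∫ t in (0 : ℝ)..(1 - s),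
    ∑ l, ∑ j, B l j (a + s • (b - a) + t • (c - a)) * (b - a) l * (c - a) j

/-- `ω^B(a, b, c) = e^{-i Γ^B(⟨a, b, c⟩)}`. -/
def omega {d : ℕ} (B : Fin d → Fin d → Conf d → ℝ) (a b c : Conf d) : ℂ :=
  exp (-I * (flux B a b c : ℂ))

/-- The differential operator `σ(X, (Q, P^A)) = ξ · Q - x · P^A` with `P^A = -i∇ - A(Q)`, applied
to `u` and evaluated at `q`. -/
def weylHamiltonian {d : ℕ} (A : Fin d → Conf d → ℝ) (X : Phase d) (u : Conf d → ℂ)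
    (q : Conf d) : ℂ :=
  (inner ℝ X.2 q : ℂ) * u q
    - ∑ j, (X.1 j : ℂ) *
        (-I * fderiv ℝ u q (EuclideanSpace.single j 1) - (A j q : ℂ) * u q)

/-- `W` is the unitary operator `e^{-iσ(X,(Q,P^A))}`: the value at time `1` of a strongly continuous
one-parameter unitary group on `L²(ℝ^d)` whose generator is `-iσ(X,(Q,P^A))` on Schwartz functions.
(For `A` smooth and polynomially bounded, Schwartz functions form a core, so there is exactly one
such group.) -/
def IsWeylOperator {d : ℕ} (A : Fin d → Conf d → ℝ) (X : Phase d) (W : L2 d ≃ₗᵢ[ℂ] L2 d) : Prop :=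
  ∃ U : ℝ → (L2 d ≃ₗᵢ[ℂ] L2 d),
    (∀ s t u, U (s + t) u = U s (U t u)) ∧
    (∀ u, Continuous fun t => U t u) ∧
    (∀ u : 𝓢(Conf d, ℂ), ∃ hu : MemLp (weylHamiltonian A X u) 2 (volume : Measure (Conf d)),
      HasDerivAt (fun t => U t (u.toLp 2)) (-I • hu.toLp (weylHamiltonian A X u)) 0) ∧
    U 1 = W

/-- The magnetic Weyl system `W^A(X) = e^{-iσ(X,(Q,P^A))}`. -/
def weylSystem {d : ℕ} (A : Fin d → Conf d → ℝ) (X : Phase d) : L2 d ≃ₗᵢ[ℂ] L2 d :=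
  Classical.epsilon (IsWeylOperator A X)

/-- The magnetic Weyl quantization `Op^A(h) = (2π)^{-d} ∫ (F_σ h)(X) W^A(X) dX`, as an operator on
all of `L²(ℝ^d)`. -/
def magneticOp {d : ℕ} (A : Fin d → Conf d → ℝ) (h : 𝓢(Phase d, ℂ)) (u : L2 d) : L2 d :=
  ((2 * Real.pi : ℝ) : ℂ)⁻¹ ^ d • ∫ X : Phase d, symplecticFourier h X • weylSystem A X u

/-- The integrand of the symplectic Fourier form of the product at `X`. -/
def fourierIntegrand {d : ℕ} (B : Fin d → Fin d → Conf d → ℝ) (f g : Phase d → ℂ)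
    (X Y Z : Phase d) : ℂ :=
  exp (I * (sigma X (Y + Z) : ℂ)) * exp (I / 2 * (sigma Y Z : ℂ)) *
    omega B (X.1 - (1 / 2 : ℝ) • (Y.1 + Z.1)) (X.1 + (1 / 2 : ℝ) • (Y.1 - Z.1))
      (X.1 + (1 / 2 : ℝ) • (Y.1 + Z.1)) *
    symplecticFourier f Y * symplecticFourier g Z

/-- The integrand of the direct form of the product at `X`. -/
def directIntegrand {d : ℕ} (B : Fin d → Fin d → Conf d → ℝ) (f g : Phase d → ℂ)
    (X Y Z : Phase d) : ℂ :=
  exp (-(2 * I) * (sigma (Y - X) (Z - X) : ℂ)) *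
    omega B (X.1 + Y.1 - Z.1) (-X.1 + Y.1 + Z.1) (X.1 - Y.1 + Z.1) *
    f Y * g Z

end MagneticWeyl

end

/-! Everything reduces to integral kernels. Solving the transport equation generated by σ(X,(Q,P^A))
gives the Weyl operator explicitly: (W^A(X)u)(q) is u(q + x) times the phase e^{-i(⟪ξ,q⟫ + ⟪ξ,x⟫/2 +
c)}, with c the circulation of A along the segment from q to q + x. This family has the required
generator, and any other admissible unitary group agrees with it on Schwartz functions, hence
everywhere (`weylSystem_eq`).

Let ĥ(m,x) = (2π)^{-d} ∫ e^{-i⟪x,η⟫} h(m,η) dη, which is `momentumFourier`. Integrating out the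
momentum shows that Op^A(h) has kernel ĥ((q+p)/2, p-q) e^{-i circulation(q,p)} (`coeFn_magneticOp`).
Such a kernel is continuous and decays in both variables, so the operator determines it pointwise;
it determines ĥ, and so h (`magneticOp_injective`).

When two kernels are composed, the circulations along q→p and p→r add up. By Stokes
(`flux_eq_circulation`) their sum is the circulation along q→r plus the flux of B through ⟨q,p,r⟩.
The product therefore again has the form of a Weyl kernel, for a symbol that involves only ω^B, f
and g (`integral_weylKernel_mul`); this gives independence of A. The symbol is Schwartz because ω^B
has temperate growth in all its corners, so it multiplies Schwartz functions into Schwartz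
functions, and integrating out one variable or Fourier transforming in one variable preserves the
Schwartz class.

For both integral formulas, the phase is linear in each momentum variable, with a coefficient
depending on the position of the other point. The momentum integrals are thus partial Fourier
transforms, and what remains is one and the same integral over two positions, up to a linear change
of variables (`integral_phaseIntegrand`). -/

noncomputable section

namespace MagneticWeyl

open scoped ContDiff Topology

/-! ### Temperate growth of parameter integrals and of unimodular phases. -/

section TemperateGrowth

/-- For |s| ≤ 1 one has 1 + ‖(x, s)‖ ≤ 2(1 + ‖x‖), whence the factor 2 ^ k. -/
theorem norm_unitIntervalIntegral_le {E G : Type} [NormedAddCommGroup E] [NormedAddCommGroup G]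
    [NormedSpace ℝ G] {F : E × ℝ → G} {k : ℕ} {C : ℝ} (hC0 : 0 ≤ C)
    (hC : ∀ p, ‖F p‖ ≤ C * (1 + ‖p‖) ^ k) (x : E) :
    ‖∫ s in (0 : ℝ)..1, F (x, s)‖ ≤ C * 2 ^ k * (1 + ‖x‖) ^ k := by
  have h := intervalIntegral.norm_integral_le_of_norm_le_const (a := (0 : ℝ)) (b := 1)
    (f := fun s => F (x, s)) (C := C * 2 ^ k * (1 + ‖x‖) ^ k) ?_
  · simpa using h
  · intro s hs
    have hs' : |s| ≤ 1 := by
      rw [Set.uIoc_of_le zero_le_one] at hs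
      rw [abs_of_pos hs.1]; exact hs.2
    refine (hC _).trans ?_
    rw [mul_assoc, ← mul_pow]
    gcongr
    rw [Prod.norm_mk]
    have := norm_nonneg x
    have h2 : max ‖x‖ ‖s‖ ≤ ‖x‖ + 1 :=
      max_le (by linarith) (by rw [Real.norm_eq_abs]; linarith)
    linarith

variable {E G : Type} [NormedAddCommGroup E] [NormedSpace ℝ E]
  [NormedAddCommGroup G] [NormedSpace ℝ G]

theorem hasTemperateGrowth_fderiv {F : E → G} (hF : F.HasTemperateGrowth) :
    (fderiv ℝ F).HasTemperateGrowth := by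
  refine ⟨hF.1.fderiv_right (by simp), fun n => ?_⟩
  obtain ⟨k, C, h⟩ := hF.2 (n + 1)
  exact ⟨k, C, fun x => by simpa [norm_iteratedFDeriv_fderiv] using h x⟩

theorem hasTemperateGrowth_clm_comp {F : E → G} {H : Type} [NormedAddCommGroup H] [NormedSpace ℝ H]
    (L : G →L[ℝ] H) (hF : F.HasTemperateGrowth) : (fun x => L (F x)).HasTemperateGrowth :=
  L.hasTemperateGrowth.comp hF

theorem hasTemperateGrowth_prodMk {H : Type} [NormedAddCommGroup H] [NormedSpace ℝ H]
    {F : E → G} {K : E → H} (hF : F.HasTemperateGrowth) (hK : K.HasTemperateGrowth) :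
    (fun x => (F x, K x)).HasTemperateGrowth := by
  have h := (hasTemperateGrowth_clm_comp (ContinuousLinearMap.inl ℝ G H) hF).add
    (hasTemperateGrowth_clm_comp (ContinuousLinearMap.inr ℝ G H) hK)
  convert h using 1
  ext x <;> simp

theorem hasTemperateGrowth_exp_neg_I_mul :
    (fun t : ℝ => exp (-I * (t : ℂ))).HasTemperateGrowth := by
  have hd : ∀ t : ℝ, HasDerivAt (fun t : ℝ => exp (-I * (t : ℂ))) (-I * exp (-I * (t : ℂ))) t := by
    intro t
    have h := ((hasDerivAt_id (t : ℂ)).const_mul (-I)).cexp.comp_ofReal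
    simpa [mul_comm] using h
  have hs : ContDiff ℝ ∞ (fun t : ℝ => exp (-I * (t : ℂ))) :=
    (contDiff_const.mul Complex.ofRealCLM.contDiff).cexp
  refine ⟨hs, fun n => ⟨0, 1, fun t => ?_⟩⟩
  have key : ∀ n : ℕ, iteratedDeriv n (fun t : ℝ => exp (-I * (t : ℂ)))
      = fun t : ℝ => (-I) ^ n * exp (-I * (t : ℂ)) := by
    intro n
    induction n with
    | zero => simp
    | succ n ih =>
      rw [iteratedDeriv_succ, ih]
      ext t
      rw [((hd t).const_mul ((-I) ^ n)).deriv]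
      ring
  rw [norm_iteratedFDeriv_eq_norm_iteratedDeriv, key]
  simp [Complex.norm_exp]

/-- This is what makes every gauge and flux phase a multiplier of the Schwartz space. -/
theorem hasTemperateGrowth_expNegI {θ : E → ℝ} (hθ : θ.HasTemperateGrowth) :
    (fun x => exp (-I * (θ x : ℂ))).HasTemperateGrowth :=
  hasTemperateGrowth_exp_neg_I_mul.comp hθ

theorem hasFDerivAt_unitIntervalIntegral {F : E × ℝ → G} (hF : F.HasTemperateGrowth) (x : E) :
    HasFDerivAt (fun x => ∫ s in (0 : ℝ)..1, F (x, s))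
      (∫ s in (0 : ℝ)..1, (fderiv ℝ F (x, s)).comp (ContinuousLinearMap.inl ℝ E ℝ)) x := by
  obtain ⟨k, C, hC0, hC⟩ := (hasTemperateGrowth_fderiv hF).norm_iteratedFDeriv_le_uniform 0
  have hb : ∀ p, ‖fderiv ℝ F p‖ ≤ C * (1 + ‖p‖) ^ k := fun p => by simpa using hC 0 le_rfl p
  have hcF : Continuous F := hF.1.continuous
  have hcF' : Continuous (fderiv ℝ F) := (hasTemperateGrowth_fderiv hF).1.continuous
  refine intervalIntegral.hasFDerivAt_integral_of_dominated_of_fderiv_le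
    (F' := fun x s => (fderiv ℝ F (x, s)).comp (ContinuousLinearMap.inl ℝ E ℝ))
    -- On the unit ball around x with |s| ≤ 1 the point (y, s) has norm at most ‖x‖ + 2, so a
    -- constant dominates.
    (bound := fun _ => C * (1 + (‖x‖ + 2)) ^ k)
    (Metric.ball_mem_nhds x one_pos) ?_ ?_ ?_ ?_ ?_ ?_
  · exact Filter.Eventually.of_forall fun y =>
      (hcF.comp (Continuous.prodMk_right y)).aestronglyMeasurable
  · exact (hcF.comp (Continuous.prodMk_right x)).intervalIntegrable _ _
  · exact ((hcF'.comp (Continuous.prodMk_right x)).clm_comp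
      continuous_const).aestronglyMeasurable
  · refine Filter.Eventually.of_forall fun s hs y hy => ?_
    have hs' : |s| ≤ 1 := by
      rw [Set.uIoc_of_le zero_le_one] at hs
      rw [abs_of_pos hs.1]; exact hs.2
    have hy' : ‖y‖ ≤ ‖x‖ + 1 := by
      have h1 : ‖y - x‖ < 1 := by simpa [dist_eq_norm] using hy
      have h2 := norm_add_le (y - x) x
      simp only [sub_add_cancel] at h2
      linarith
    calc ‖(fderiv ℝ F (y, s)).comp (ContinuousLinearMap.inl ℝ E ℝ)‖
        ≤ ‖fderiv ℝ F (y, s)‖ * ‖ContinuousLinearMap.inl ℝ E ℝ‖ :=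
          ContinuousLinearMap.opNorm_comp_le _ _
      _ ≤ ‖fderiv ℝ F (y, s)‖ * 1 := by
          gcongr; exact ContinuousLinearMap.norm_inl_le_one ℝ E ℝ
      _ ≤ C * (1 + ‖(y, s)‖) ^ k := by rw [mul_one]; exact hb _
      _ ≤ C * (1 + (‖x‖ + 2)) ^ k := by
          gcongr
          rw [Prod.norm_mk]
          exact max_le (by linarith) (by rw [Real.norm_eq_abs]; linarith [norm_nonneg x])
  · exact intervalIntegrable_const
  · refine Filter.Eventually.of_forall fun s _ y _ => ?_
    have h1 : HasFDerivAt F (fderiv ℝ F (y, s)) (y, s) :=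
      (hF.1.differentiable (by simp) _).hasFDerivAt
    exact h1.comp y (hasFDerivAt_prodMk_left y s)

/-- The derivative is again an integral over the unit interval of a temperate function, but with
values in `E →L[ℝ] G`. The induction therefore has to quantify over the codomain. -/
theorem contDiff_unitIntervalIntegral (n : ℕ) : ∀ (G : Type) [NormedAddCommGroup G]
    [NormedSpace ℝ G] (F : E × ℝ → G), F.HasTemperateGrowth →
    ContDiff ℝ n (fun x => ∫ s in (0 : ℝ)..1, F (x, s)) ∧
    ∃ (k : ℕ) (C : ℝ), ∀ x,
      ‖iteratedFDeriv ℝ n (fun x => ∫ s in (0 : ℝ)..1, F (x, s)) x‖ ≤ C * (1 + ‖x‖) ^ k := by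
  induction n with
  | zero =>
    intro G _ _ F hF
    obtain ⟨k, C, hC0, hC⟩ := hF.norm_iteratedFDeriv_le_uniform 0
    refine ⟨?_, k, C * 2 ^ k, fun x => ?_⟩
    · rw [Nat.cast_zero, contDiff_zero]
      exact continuous_iff_continuousAt.2 fun x =>
        (hasFDerivAt_unitIntervalIntegral hF x).continuousAt
    · rw [norm_iteratedFDeriv_zero]
      exact norm_unitIntervalIntegral_le hC0 (fun p => by simpa using hC 0 le_rfl p) x
  | succ n ih =>
    intro G _ _ F hF
    have hF' : (fun p => (fderiv ℝ F p).comp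
        (ContinuousLinearMap.inl ℝ E ℝ)).HasTemperateGrowth :=
      hasTemperateGrowth_clm_comp ((ContinuousLinearMap.compL ℝ E (E × ℝ) G).flip
        (ContinuousLinearMap.inl ℝ E ℝ)) (hasTemperateGrowth_fderiv hF)
    have hfd : fderiv ℝ (fun x => ∫ s in (0 : ℝ)..1, F (x, s)) = fun x => ∫ s in (0 : ℝ)..1,
        (fderiv ℝ F (x, s)).comp (ContinuousLinearMap.inl ℝ E ℝ) :=
      funext fun x => (hasFDerivAt_unitIntervalIntegral hF x).fderiv
    obtain ⟨h1, k, C, h2⟩ := ih _ _ hF'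
    refine ⟨?_, k, C, fun x => ?_⟩
    · rw [Nat.cast_succ]
      refine contDiff_succ_iff_fderiv.2 ⟨fun x =>
        (hasFDerivAt_unitIntervalIntegral hF x).differentiableAt, by simp, ?_⟩
      rw [hfd]; exact h1
    · rw [← norm_iteratedFDeriv_fderiv, hfd]
      exact h2 x

theorem hasTemperateGrowth_unitIntervalIntegral {F : E × ℝ → G} (hF : F.HasTemperateGrowth) :
    (fun x => ∫ s in (0 : ℝ)..1, F (x, s)).HasTemperateGrowth :=
  ⟨contDiff_infty.2 fun n => (contDiff_unitIntervalIntegral n G F hF).1,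
    fun n => (contDiff_unitIntervalIntegral n G F hF).2⟩

end TemperateGrowth

end MagneticWeyl

end

noncomputable section

namespace MagneticWeyl

open scoped ContDiff Topology FourierTransform RealInnerProductSpace

/-! ### Polynomial weights and Schwartz decay. -/

section Decay

theorem exists_norm_iteratedFDeriv_le {E F : Type*} [NormedAddCommGroup E] [NormedSpace ℝ E]
    [NormedAddCommGroup F] [NormedSpace ℝ F] (f : 𝓢(E, F)) (k n : ℕ) :
    ∃ C, 0 ≤ C ∧ ∀ x, (1 + ‖x‖) ^ k * ‖iteratedFDeriv ℝ n f x‖ ≤ C :=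
  ⟨_, le_trans (by positivity)
    (SchwartzMap.one_add_le_sup_seminorm_apply (𝕜 := ℝ) (m := (k, n)) le_rfl le_rfl f 0),
    fun x => SchwartzMap.one_add_le_sup_seminorm_apply (𝕜 := ℝ) (m := (k, n)) le_rfl le_rfl f x⟩

theorem exists_norm_le {E F : Type*} [NormedAddCommGroup E] [NormedSpace ℝ E]
    [NormedAddCommGroup F] [NormedSpace ℝ F] (f : 𝓢(E, F)) (k : ℕ) :
    ∃ C, 0 ≤ C ∧ ∀ x, (1 + ‖x‖) ^ k * ‖f x‖ ≤ C := by
  simpa using exists_norm_iteratedFDeriv_le f k 0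

variable {V : Type*} [NormedAddCommGroup V] [NormedSpace ℝ V] [FiniteDimensional ℝ V]
  [MeasurableSpace V] [BorelSpace V]

theorem integrable_inv_one_add_norm_pow (μ : Measure V) [μ.IsAddHaarMeasure] {k : ℕ}
    (hk : Module.finrank ℝ V < k) : Integrable (fun v : V => ((1 + ‖v‖) ^ k)⁻¹) μ := by
  have h := integrable_one_add_norm (E := V) (μ := μ) (r := k) (by exact_mod_cast hk)
  refine h.congr (Filter.Eventually.of_forall fun v => ?_)
  simp only
  rw [Real.rpow_neg (by positivity), Real.rpow_natCast]

end Decay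

/-! ### The partial Fourier transform on Schwartz space. -/

section PartialFourier

theorem antilipschitz_slice {W V : Type*} [NormedAddCommGroup W] [NormedAddCommGroup V] (w : W) :
    AntilipschitzWith 1 (fun η : V => (w, η)) :=
  AntilipschitzWith.of_le_mul_dist fun x y => by simp [Prod.dist_eq]

variable {W V : Type} [NormedAddCommGroup W] [NormedSpace ℝ W]
  [NormedAddCommGroup V]

theorem slice_hasTemperateGrowth [NormedSpace ℝ V] (w : W) :
    (fun η : V => (w, η)).HasTemperateGrowth :=
  hasTemperateGrowth_prodMk (hK := .id') (hF := .const w)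

/-- The Schwartz function `η ↦ h (w, η)`. -/
def slice [NormedSpace ℝ V] {E : Type} [NormedAddCommGroup E] [NormedSpace ℝ E] (h : 𝓢(W × V, E))
    (w : W) : 𝓢(V, E) :=
  SchwartzMap.compCLMOfAntilipschitz ℝ (slice_hasTemperateGrowth w) (antilipschitz_slice w) h

theorem slice_apply [NormedSpace ℝ V] {E : Type} [NormedAddCommGroup E] [NormedSpace ℝ E]
    (h : 𝓢(W × V, E)) (w : W) (η : V) : slice h w η = h (w, η) := rfl

theorem norm_iteratedFDeriv_slice_le [NormedSpace ℝ V] {E : Type} [NormedAddCommGroup E]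
    [NormedSpace ℝ E] (h : 𝓢(W × V, E)) (w : W) (n : ℕ) (η : V) :
    ‖iteratedFDeriv ℝ n (slice h w) η‖ ≤ ‖iteratedFDeriv ℝ n h (w, η)‖ := by
  have h1 : (slice h w : V → E)
      = (fun p => h (p + ((w, 0) : W × V))) ∘ (ContinuousLinearMap.inr ℝ W V) := by
    ext η; simp [slice_apply]
  have h2 : ContDiff ℝ n (fun p => h (p + ((w, 0) : W × V))) :=
    (h.smooth n).comp (contDiff_id.add contDiff_const)
  rw [h1, (ContinuousLinearMap.inr ℝ W V).iteratedFDeriv_comp_right h2 η le_rfl,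
    iteratedFDeriv_comp_add_right]
  have h3 : (ContinuousLinearMap.inr ℝ W V) η + (w, 0) = (w, η) := by simp
  rw [h3]
  refine (ContinuousMultilinearMap.norm_compContinuousLinearMap_le _ _).trans ?_
  refine mul_le_of_le_one_right (norm_nonneg _) ?_
  rw [Finset.prod_const]
  exact pow_le_one₀ (norm_nonneg _) (ContinuousLinearMap.norm_inr_le_one ℝ W V)

variable [InnerProductSpace ℝ V]

section Derivative

variable {E : Type} [NormedAddCommGroup E] [NormedSpace ℂ E]

variable (W V) in
/-- The bilinear pairing `((w, η), (a, b)) ↦ ⟪η, b⟫`. -/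
def sndPairing : W × V →L[ℝ] W × V →L[ℝ] ℝ :=
  ((innerSL ℝ : V →L[ℝ] V →L[ℝ] ℝ).bilinearComp
    (ContinuousLinearMap.snd ℝ W V) (ContinuousLinearMap.snd ℝ W V))

/-- The Schwartz function whose partial Fourier transform is the derivative of the partial
Fourier transform of `h`. -/
def partialFourierDeriv (h : 𝓢(W × V, E)) : 𝓢(W × V, W × V →L[ℝ] E) :=
  SchwartzMap.postcompCLM (𝕜 := ℝ) ((ContinuousLinearMap.compL ℝ (W × V) (W × V) E).flip
      ((ContinuousLinearMap.inl ℝ W V).comp (ContinuousLinearMap.fst ℝ W V)))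
    (SchwartzMap.fderivCLM ℝ (W × V) E h)
  + ((-(2 * Real.pi * I) : ℂ) • SchwartzMap.smulRightCLM ℝ E (sndPairing W V) h)

theorem partialFourierDeriv_apply (h : 𝓢(W × V, E)) (p q : W × V) :
    partialFourierDeriv h p q = fderiv ℝ h p (q.1, 0)
      + (-(2 * Real.pi * I) : ℂ) • (⟪p.2, q.2⟫ • h p) := by
  simp [partialFourierDeriv, sndPairing]

variable [FiniteDimensional ℝ V] [MeasurableSpace V] [BorelSpace V]

/-- Differentiation in w falls on h, and differentiation in v brings down -2πi⟪η, ·⟫. Both effects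
are collected in a single operator-valued Schwartz function, so that the derivative has the same
shape as the original and the argument can be iterated. -/
theorem hasFDerivAt_fourier_slice (h : 𝓢(W × V, E)) (p : W × V) :
    HasFDerivAt (fun p : W × V => 𝓕 (slice h p.1 : V → E) p.2)
      (𝓕 (slice (partialFourierDeriv h) p.1 : V → W × V →L[ℝ] E) p.2) p := by
  simp only [Real.fourier_eq', slice_apply]
  obtain ⟨C, hC0, hC⟩ := exists_norm_le (partialFourierDeriv h) (Module.finrank ℝ V + 1)
  have hphase : ∀ v : V, Continuous fun η : V => exp (((-2 * Real.pi * ⟪η, v⟫ : ℝ) : ℂ) * I) :=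
    fun v => by fun_prop
  have hslice : ∀ {G : Type} [NormedAddCommGroup G] [NormedSpace ℝ G] (k : 𝓢(W × V, G)) (w : W),
    Continuous fun η : V => k (w, η) := fun k w => k.continuous.comp (by fun_prop)
  refine hasFDerivAt_integral_of_dominated_of_fderiv_le
    (F := fun (p : W × V) (η : V) => exp (((-2 * Real.pi * ⟪η, p.2⟫ : ℝ) : ℂ) * I) • h (p.1, η))
    (F' := fun (p : W × V) (η : V) => exp (((-2 * Real.pi * ⟪η, p.2⟫ : ℝ) : ℂ) * I) •
      partialFourierDeriv h (p.1, η))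
    (bound := fun η => C * ((1 + ‖η‖) ^ (Module.finrank ℝ V + 1))⁻¹)
    Filter.univ_mem ?_ ?_ ?_ ?_ ?_ ?_
  · exact Filter.Eventually.of_forall fun q =>
      ((hphase q.2).smul (hslice h q.1)).aestronglyMeasurable
  · refine ((slice h p.1).integrable.norm).mono'
      ((hphase p.2).smul (hslice h p.1)).aestronglyMeasurable
      (Filter.Eventually.of_forall fun η => ?_)
    rw [norm_smul, Complex.norm_exp_ofReal_mul_I, one_mul, slice_apply]
  · exact ((hphase p.2).smul (hslice _ p.1)).aestronglyMeasurable
  · refine Filter.Eventually.of_forall fun η q _ => ?_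
    rw [norm_smul, Complex.norm_exp_ofReal_mul_I, one_mul, ← div_eq_mul_inv,
      le_div_iff₀ (by positivity), mul_comm]
    refine le_trans ?_ (hC (q.1, η))
    gcongr
    exact le_max_right _ _
  · exact (integrable_inv_one_add_norm_pow volume (Nat.lt_succ_self _)).const_mul C
  · refine Filter.Eventually.of_forall fun η q _ => ?_
    have h1 : HasFDerivAt (fun q : W × V => h (q.1, η))
        ((fderiv ℝ h (q.1, η)).comp ((ContinuousLinearMap.inl ℝ W V).comp
          (ContinuousLinearMap.fst ℝ W V))) q := by
      have h2 : HasFDerivAt (fun q : W × V => (q.1, η)) ((ContinuousLinearMap.inl ℝ W V).comp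
          (ContinuousLinearMap.fst ℝ W V)) q :=
        HasFDerivAt.comp (g := fun w : W => (w, η)) q (hasFDerivAt_prodMk_left q.1 η) hasFDerivAt_fst
      exact (h.differentiableAt.hasFDerivAt (x := (q.1, η))).comp q h2
    have h3 : HasFDerivAt (fun q : W × V => -2 * Real.pi * ⟪η, q.2⟫)
        ((-2 * Real.pi) • ((innerSL ℝ η).comp (ContinuousLinearMap.snd ℝ W V))) q :=
      (((innerSL ℝ η).hasFDerivAt.comp q hasFDerivAt_snd).const_mul (-2 * Real.pi))
    have h4 : HasFDerivAt (fun q : W × V => exp (((-2 * Real.pi * ⟪η, q.2⟫ : ℝ) : ℂ) * I))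
        _ q := ((Complex.ofRealCLM.hasFDerivAt.comp q h3).mul_const I).cexp
    refine (h4.smul h1).congr_fderiv (ContinuousLinearMap.ext fun r => ?_)
    simp only [_root_.smul_apply, partialFourierDeriv_apply,
      _root_.add_apply, ContinuousLinearMap.comp_apply,
      ContinuousLinearMap.smulRight_apply, ContinuousLinearMap.inl_apply,
      ContinuousLinearMap.coe_fst', ContinuousLinearMap.coe_snd', innerSL_apply_apply,
      ofRealCLM_apply, smul_add]
    congr 1
    rw [← Complex.coe_smul]
    simp only [smul_smul]
    congr 1
    simp
    ring

/-- Powers of ‖w‖ are absorbed by the decay of h. Powers of ‖v‖ are exchanged for derivatives of the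
slice, whose integrals are bounded uniformly in w. -/
theorem exists_norm_fourier_slice_le (h : 𝓢(W × V, E)) (k : ℕ) :
    ∃ C, ∀ p : W × V, ‖p‖ ^ k * ‖𝓕 (slice h p.1 : V → E) p.2‖ ≤ C := by
  set N := Module.finrank ℝ V + 1
  have hint : Integrable (fun v : V => ((1 + ‖v‖) ^ N)⁻¹) :=
    integrable_inv_one_add_norm_pow volume (Nat.lt_succ_self _)
  obtain ⟨C₁, hC₁0, hC₁⟩ := exists_norm_le h (k + N)
  choose D hD0 hD using fun n => exists_norm_iteratedFDeriv_le h N n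
  set J := ∫ v : V, ((1 + ‖v‖) ^ N)⁻¹
  have hfst : ∀ p : W × V, ‖p.1‖ ^ k * ‖𝓕 (slice h p.1 : V → E) p.2‖ ≤ C₁ * J := by
    intro p
    have h1 : ‖𝓕 (slice h p.1 : V → E) p.2‖ ≤ ∫ η : V, ‖h (p.1, η)‖ :=
      VectorFourier.norm_fourierIntegral_le_integral_norm _ _ _ _ _
    calc ‖p.1‖ ^ k * ‖𝓕 (slice h p.1 : V → E) p.2‖
        ≤ ‖p.1‖ ^ k * ∫ η : V, ‖h (p.1, η)‖ := by gcongr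
      _ = ∫ η : V, ‖p.1‖ ^ k * ‖h (p.1, η)‖ := (integral_const_mul _ _).symm
      _ ≤ ∫ η : V, C₁ * ((1 + ‖η‖) ^ N)⁻¹ := by
          refine integral_mono ((slice h p.1).integrable.norm.const_mul _)
            (hint.const_mul _) fun η => ?_
          simp only
          rw [← div_eq_mul_inv, le_div_iff₀ (by positivity)]
          refine le_trans ?_ (hC₁ (p.1, η))
          rw [pow_add _ k N, mul_right_comm]
          have h2 : ‖p.1‖ ≤ 1 + ‖(p.1, η)‖ :=
            (norm_fst_le (p.1, η)).trans (le_add_of_nonneg_left zero_le_one)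
          have h3 : ‖η‖ ≤ ‖(p.1, η)‖ := norm_snd_le (p.1, η)
          gcongr
      _ = C₁ * J := integral_const_mul _ _
  have hsnd : ∀ p : W × V, ‖p.2‖ ^ k * ‖𝓕 (slice h p.1 : V → E) p.2‖
      ≤ 2 ^ k * ∑ n ∈ Finset.range (k + 1), D n * J := by
    intro p
    -- No derivative of the transform and k powers of the frequency: the sum runs over at most k
    -- derivatives of the slice, and the constant is 2 ^ k.
    have h1 := Real.pow_mul_norm_iteratedFDeriv_fourier_le (K := ⊤) (N := ⊤)
      (f := (slice h p.1 : V → E)) ((slice h p.1).smooth ⊤)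
      (fun k n _ _ => (slice h p.1).integrable_pow_mul_iteratedFDeriv volume k n)
      (k := 0) (n := k) le_top le_top p.2
    simp only [norm_iteratedFDeriv_zero, pow_zero, one_mul, CharP.cast_eq_zero, mul_zero,
      zero_add, Finset.range_one, Finset.singleton_product, Finset.sum_map,
      Function.Embedding.coeFn_mk] at h1
    refine h1.trans ?_
    gcongr with n _
    rw [← integral_const_mul]
    refine integral_mono ?_ (hint.const_mul _) fun η => ?_
    · simpa using (slice h p.1).integrable_pow_mul_iteratedFDeriv volume 0 n
    · simp only
      rw [← div_eq_mul_inv, le_div_iff₀ (by positivity), mul_comm]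
      refine le_trans ?_ (hD n (p.1, η))
      gcongr
      · exact norm_snd_le (p.1, η)
      · exact norm_iteratedFDeriv_slice_le h p.1 n η
  refine ⟨C₁ * J + 2 ^ k * ∑ n ∈ Finset.range (k + 1), D n * J, fun p => ?_⟩
  have h1 : ‖p‖ ^ k ≤ ‖p.1‖ ^ k + ‖p.2‖ ^ k := by
    rcases le_total ‖p.1‖ ‖p.2‖ with h | h
    · rw [Prod.norm_def, max_eq_right h]; exact le_add_of_nonneg_left (by positivity)
    · rw [Prod.norm_def, max_eq_left h]; exact le_add_of_nonneg_right (by positivity)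
  calc _ ≤ (‖p.1‖ ^ k + ‖p.2‖ ^ k) * ‖𝓕 (slice h p.1 : V → E) p.2‖ := by gcongr
    _ ≤ _ := by rw [add_mul]; exact add_le_add (hfst p) (hsnd p)

end Derivative

variable [FiniteDimensional ℝ V] [MeasurableSpace V] [BorelSpace V]

/-- Induction on the order, over all targets E at once, since each derivative replaces E by `W × V
→L[ℝ] E`. -/
theorem contDiff_fourier_slice (n : ℕ) : ∀ (E : Type) [NormedAddCommGroup E] [NormedSpace ℂ E]
    (h : 𝓢(W × V, E)), ContDiff ℝ n (fun p : W × V => 𝓕 (slice h p.1 : V → E) p.2) ∧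
    ∀ k : ℕ, ∃ C, ∀ p : W × V, ‖p‖ ^ k *
      ‖iteratedFDeriv ℝ n (fun p : W × V => 𝓕 (slice h p.1 : V → E) p.2) p‖ ≤ C := by
  induction n with
  | zero =>
    intro E _ _ h
    refine ⟨?_, fun k => ?_⟩
    · rw [Nat.cast_zero, contDiff_zero]
      exact continuous_iff_continuousAt.2 fun p => (hasFDerivAt_fourier_slice h p).continuousAt
    · simpa only [norm_iteratedFDeriv_zero] using exists_norm_fourier_slice_le h k
  | succ n ih =>
    intro E _ _ h
    have hfd : fderiv ℝ (fun p : W × V => 𝓕 (slice h p.1 : V → E) p.2) = fun p : W × V =>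
        𝓕 (slice (partialFourierDeriv h) p.1 : V → W × V →L[ℝ] E) p.2 :=
      funext fun p => (hasFDerivAt_fourier_slice h p).fderiv
    obtain ⟨h1, h2⟩ := ih (W × V →L[ℝ] E) (partialFourierDeriv h)
    refine ⟨?_, fun k => ?_⟩
    · rw [Nat.cast_succ]
      refine contDiff_succ_iff_fderiv.2 ⟨fun p =>
        (hasFDerivAt_fourier_slice h p).differentiableAt, by simp, ?_⟩
      rw [hfd]; exact h1
    · simp only [← norm_iteratedFDeriv_fderiv, hfd]
      exact h2 k

/-- The partial Fourier transform `(w, v) ↦ ∫ e^{-2πi⟪η, v⟫} h(w, η) dη` of a Schwartz function. -/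
def fourierSnd (h : 𝓢(W × V, ℂ)) : 𝓢(W × V, ℂ) where
  toFun p := 𝓕 (slice h p.1 : V → ℂ) p.2
  smooth' := contDiff_infty.2 fun n => (contDiff_fourier_slice n ℂ h).1
  decay' k n := (contDiff_fourier_slice n ℂ h).2 k

variable (W V) in
/-- The linear equivalence `(w, v) ↦ (w, (2π)⁻¹ v)`. -/
def scaleSnd : (W × V) ≃L[ℝ] (W × V) :=
  (ContinuousLinearEquiv.refl ℝ W).prodCongr
    (ContinuousLinearEquiv.smulLeft (Units.mk0 (2 * Real.pi)⁻¹ (by positivity)))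

/-- The partial Fourier transform `(w, v) ↦ ∫ e^{-i⟪v, η⟫} h(w, η) dη` of a Schwartz function. -/
def partialFourier (h : 𝓢(W × V, ℂ)) : 𝓢(W × V, ℂ) :=
  SchwartzMap.compCLMOfContinuousLinearEquiv ℝ (scaleSnd W V) (fourierSnd h)

theorem partialFourier_eq (h : 𝓢(W × V, ℂ)) (w : W) (v : V) :
    partialFourier h (w, v) = 𝓕 (slice h w : V → ℂ) ((2 * Real.pi)⁻¹ • v) := rfl

theorem partialFourier_apply (h : 𝓢(W × V, ℂ)) (w : W) (v : V) :
    partialFourier h (w, v) = ∫ η : V, exp (-I * (⟪v, η⟫ : ℂ)) * h (w, η) := by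
  rw [partialFourier_eq, Real.fourier_eq']
  refine integral_congr_ae (Filter.Eventually.of_forall fun η => ?_)
  simp only [slice_apply, smul_eq_mul]
  congr 2
  rw [inner_smul_right, real_inner_comm, ← mul_assoc, mul_assoc (-2 : ℝ)]
  have : (2 * Real.pi) * (2 * Real.pi)⁻¹ = 1 := mul_inv_cancel₀ (by positivity)
  rw [show -2 * (Real.pi * (2 * Real.pi)⁻¹) = -1 by linear_combination (-1 : ℝ) * this]
  push_cast
  ring

/-- Inversion formula for the partial Fourier transform. -/
theorem integral_exp_mul_partialFourier (h : 𝓢(W × V, ℂ)) (w : W) (ξ : V) :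
    ∫ v : V, exp (I * (⟪ξ, v⟫ : ℂ)) * partialFourier h (w, v)
      = ((2 * Real.pi : ℝ) : ℂ) ^ Module.finrank ℝ V * h (w, ξ) := by
  have h1 : 𝓕⁻ (𝓕 (slice h w : V → ℂ)) ξ = h (w, ξ) := by
    have := FourierTransform.fourierInv_fourier_eq (F := 𝓢(V, ℂ)) (slice h w)
    rw [← slice_apply, ← SchwartzMap.fourier_coe, ← SchwartzMap.fourierInv_coe, this]
  rw [← h1, Real.fourierInv_eq']
  -- Passing from the kernel e^{2πi⟪v,ξ⟫} to e^{i⟪ξ,v⟫} rescales v by 2π; the Jacobian is the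
  -- constant in the claim.
  have h2 := Measure.integral_comp_inv_smul (volume : Measure V)
    (fun v : V => exp ((2 * Real.pi * ⟪v, ξ⟫ : ℝ) * I) • 𝓕 (slice h w : V → ℂ) v) (2 * Real.pi)
  rw [abs_of_pos (by positivity), Complex.real_smul] at h2
  push_cast at h2 ⊢
  rw [← h2]
  refine integral_congr_ae (Filter.Eventually.of_forall fun v => ?_)
  simp only [smul_eq_mul, partialFourier_eq]
  congr 2
  rw [inner_smul_left, real_inner_comm]
  simp only [map_inv₀, map_mul, conj_trivial]
  push_cast
  have : (Real.pi : ℂ) ≠ 0 := by exact_mod_cast Real.pi_ne_zero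
  field_simp

end PartialFourier

/-! ### Tensor products of Schwartz functions. -/

section Tensor

variable {E F : Type} [NormedAddCommGroup E] [NormedSpace ℝ E]
  [NormedAddCommGroup F] [NormedSpace ℝ F]

theorem norm_iteratedFDeriv_comp_clm_le {G : Type*} [NormedAddCommGroup G] [NormedSpace ℝ G]
    {f : E → G} (hf : ContDiff ℝ ∞ f) (L : F →L[ℝ] E) (hL : ‖L‖ ≤ 1) (n : ℕ) (x : F) :
    ‖iteratedFDeriv ℝ n (f ∘ L) x‖ ≤ ‖iteratedFDeriv ℝ n f (L x)‖ := by
  rw [L.iteratedFDeriv_comp_right hf x (by exact_mod_cast le_top)]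
  refine (ContinuousMultilinearMap.norm_compContinuousLinearMap_le _ _).trans ?_
  refine mul_le_of_le_one_right (norm_nonneg _) ?_
  rw [Finset.prod_const]
  exact pow_le_one₀ (norm_nonneg _) hL

/-- The tensor product `(x, y) ↦ f x * g y` of two Schwartz functions. -/
def tensor (f : 𝓢(E, ℂ)) (g : 𝓢(F, ℂ)) : 𝓢(E × F, ℂ) where
  toFun p := f p.1 * g p.2
  smooth' := (f.smooth'.comp contDiff_fst).mul (g.smooth'.comp contDiff_snd)
  decay' k n := by
    choose C hC0 hC using fun i => exists_norm_iteratedFDeriv_le f k i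
    choose D hD0 hD using fun i => exists_norm_iteratedFDeriv_le g k i
    refine ⟨∑ i ∈ Finset.range (n + 1), (n.choose i : ℝ) * (C i * D (n - i)), fun p => ?_⟩
    have h1 := norm_iteratedFDeriv_mul_le (N := ∞) (f.smooth'.comp contDiff_fst)
      (g.smooth'.comp contDiff_snd) p (n := n) (by exact_mod_cast le_top)
    refine (mul_le_mul_of_nonneg_left h1 (by positivity)).trans ?_
    rw [Finset.mul_sum]
    refine Finset.sum_le_sum fun i _ => ?_
    have h2 := norm_iteratedFDeriv_comp_clm_le f.smooth' (ContinuousLinearMap.fst ℝ E F)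
      (ContinuousLinearMap.norm_fst_le ℝ E F) i p
    have h3 := norm_iteratedFDeriv_comp_clm_le g.smooth' (ContinuousLinearMap.snd ℝ E F)
      (ContinuousLinearMap.norm_snd_le ℝ E F) (n - i) p
    -- The norm is the maximum of the two components, so the weight splits into a product and each
    -- factor uses its own decay.
    have h4 : ‖p‖ ^ k ≤ (1 + ‖p.1‖) ^ k * (1 + ‖p.2‖) ^ k := by
      rw [← mul_pow]
      gcongr
      rw [Prod.norm_def]
      refine max_le ?_ ?_ <;> nlinarith [norm_nonneg p.1, norm_nonneg p.2]
    calc ‖p‖ ^ k * ((n.choose i : ℝ) * ‖iteratedFDeriv ℝ i (f ∘ Prod.fst) p‖ *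
          ‖iteratedFDeriv ℝ (n - i) (g ∘ Prod.snd) p‖)
        ≤ ((1 + ‖p.1‖) ^ k * (1 + ‖p.2‖) ^ k) * ((n.choose i : ℝ) * ‖iteratedFDeriv ℝ i f p.1‖ *
          ‖iteratedFDeriv ℝ (n - i) g p.2‖) := by
          gcongr
          · exact h2
          · exact h3
      _ = (n.choose i : ℝ) * (((1 + ‖p.1‖) ^ k * ‖iteratedFDeriv ℝ i f p.1‖) *
          ((1 + ‖p.2‖) ^ k * ‖iteratedFDeriv ℝ (n - i) g p.2‖)) := by ring
      _ ≤ (n.choose i : ℝ) * (C i * D (n - i)) := by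
          gcongr
          · exact hC0 i
          · exact hC i p.1
          · exact hD (n - i) p.2

theorem tensor_apply (f : 𝓢(E, ℂ)) (g : 𝓢(F, ℂ)) (x : E) (y : F) :
    tensor f g (x, y) = f x * g y := rfl

end Tensor

end MagneticWeyl

end

noncomputable section

namespace MagneticWeyl

open scoped ContDiff Topology RealInnerProductSpace

/-! ### Circulation, flux, Stokes' theorem and the Poincaré lemma. -/

section Gauge

variable {d : ℕ}

theorem clm_apply_eq_sum {G : Type*} [NormedAddCommGroup G] [NormedSpace ℝ G]
    (L : Conf d →L[ℝ] G) (w : Conf d) :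
    L w = ∑ l, w l • L (EuclideanSpace.single l 1) := by
  conv_lhs => rw [← (EuclideanSpace.basisFun (Fin d) ℝ).sum_repr w]
  simp

theorem hasTemperateGrowth_coord {E : Type} [NormedAddCommGroup E] [NormedSpace ℝ E]
    {F : E → Conf d} (hF : F.HasTemperateGrowth) (j : Fin d) :
    (fun x => F x j).HasTemperateGrowth :=
  hasTemperateGrowth_clm_comp (EuclideanSpace.proj j : Conf d →L[ℝ] ℝ) hF

/-- The line integral of the 1-form `A` along the segment from `a` to `b`. -/
def circulation (A : Fin d → Conf d → ℝ) (a b : Conf d) : ℝ :=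
  ∫ s in (0 : ℝ)..1, ∑ j, A j (a + s • (b - a)) * (b - a) j

theorem hasTemperateGrowth_circulation {A : Fin d → Conf d → ℝ}
    (hA : ∀ j, (A j).HasTemperateGrowth) {E : Type} [NormedAddCommGroup E] [NormedSpace ℝ E]
    {a b : E → Conf d} (ha : a.HasTemperateGrowth) (hb : b.HasTemperateGrowth) :
    (fun x => circulation A (a x) (b x)).HasTemperateGrowth := by
  have hfst : (fun p : E × ℝ => p.1).HasTemperateGrowth :=
    (ContinuousLinearMap.fst ℝ E ℝ).hasTemperateGrowth
  have hsnd : (fun p : E × ℝ => p.2).HasTemperateGrowth :=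
    (ContinuousLinearMap.snd ℝ E ℝ).hasTemperateGrowth
  have ha' := ha.comp hfst
  have hb' := hb.comp hfst
  refine hasTemperateGrowth_unitIntervalIntegral (F := fun p : E × ℝ =>
    ∑ j, A j (a p.1 + p.2 • (b p.1 - a p.1)) * (b p.1 - a p.1) j) ?_
  exact .sum fun j _ => ((hA j).comp (ha'.add (hsnd.smul (hb'.sub ha')))).mul
    (hasTemperateGrowth_coord (hb'.sub ha') j)

/-- The substitution t = (1 - s) r, with Jacobian 1 - s, turns the triangle into the unit square.
Fixed limits are what both the temperate growth lemma and the divergence theorem need. -/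
theorem flux_eq (B : Fin d → Fin d → Conf d → ℝ) (a b c : Conf d) :
    flux B a b c = ∫ s in (0 : ℝ)..1, ∫ r in (0 : ℝ)..1, (1 - s) *
      ∑ l, ∑ j, B l j (a + s • (b - a) + ((1 - s) * r) • (c - a)) * (b - a) l * (c - a) j := by
  unfold flux
  congr 1
  ext s
  rw [intervalIntegral.integral_const_mul]
  have h := intervalIntegral.mul_integral_comp_mul_left (a := 0) (b := 1)
    (f := fun t => ∑ l, ∑ j, B l j (a + s • (b - a) + t • (c - a)) * (b - a) l * (c - a) j) (1 - s)
  simp only [mul_zero, mul_one] at h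
  exact h.symm

theorem hasTemperateGrowth_flux {B : Fin d → Fin d → Conf d → ℝ}
    (hB : ∀ l j, (B l j).HasTemperateGrowth) {E : Type} [NormedAddCommGroup E] [NormedSpace ℝ E]
    {a b c : E → Conf d} (ha : a.HasTemperateGrowth) (hb : b.HasTemperateGrowth)
    (hc : c.HasTemperateGrowth) :
    (fun x => flux B (a x) (b x) (c x)).HasTemperateGrowth := by
  simp only [flux_eq]
  have hx : (fun p : (E × ℝ) × ℝ => p.1.1).HasTemperateGrowth :=
    ((ContinuousLinearMap.fst ℝ E ℝ).comp (ContinuousLinearMap.fst ℝ _ ℝ)).hasTemperateGrowth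
  have hs : (fun p : (E × ℝ) × ℝ => p.1.2).HasTemperateGrowth :=
    ((ContinuousLinearMap.snd ℝ E ℝ).comp (ContinuousLinearMap.fst ℝ _ ℝ)).hasTemperateGrowth
  have hr : (fun p : (E × ℝ) × ℝ => p.2).HasTemperateGrowth :=
    (ContinuousLinearMap.snd ℝ (E × ℝ) ℝ).hasTemperateGrowth
  have ha' := ha.comp hx
  have hb' := hb.comp hx
  have hc' := hc.comp hx
  have hs' := (Function.HasTemperateGrowth.const (E := (E × ℝ) × ℝ) (1 : ℝ)).sub hs
  refine hasTemperateGrowth_unitIntervalIntegral (F := fun p : E × ℝ =>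
    ∫ r in (0 : ℝ)..1, (1 - p.2) * ∑ l, ∑ j, B l j (a p.1 + p.2 • (b p.1 - a p.1) +
      ((1 - p.2) * r) • (c p.1 - a p.1)) * (b p.1 - a p.1) l * (c p.1 - a p.1) j) ?_
  refine hasTemperateGrowth_unitIntervalIntegral (F := fun p : (E × ℝ) × ℝ =>
    (1 - p.1.2) * ∑ l, ∑ j, B l j (a p.1.1 + p.1.2 • (b p.1.1 - a p.1.1) +
      ((1 - p.1.2) * p.2) • (c p.1.1 - a p.1.1)) * (b p.1.1 - a p.1.1) l
        * (c p.1.1 - a p.1.1) j) ?_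
  refine hs'.mul (.sum fun l _ => .sum fun j _ => ?_)
  exact (((hB l j).comp ((ha'.add (hs.smul (hb'.sub ha'))).add
    ((hs'.mul hr).smul (hc'.sub ha')))).mul (hasTemperateGrowth_coord (hb'.sub ha') l)).mul
    (hasTemperateGrowth_coord (hc'.sub ha') j)

/-- **Stokes' theorem** on a triangle. -/
theorem flux_eq_circulation {B : Fin d → Fin d → Conf d → ℝ} {A : Fin d → Conf d → ℝ}
    (hA : IsPolVectorPotential B A) (a b c : Conf d) :
    flux B a b c = circulation A a b + circulation A b c - circulation A a c := by
  set u := b - a with hu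
  set v := c - a with hv
  -- This map takes the unit square onto the triangle: the sides r = 0, s = 0 and r = 1 go to ab, ac
  -- and cb, while the side s = 1 collapses to b.
  set γ : ℝ × ℝ → Conf d := fun p => a + p.1 • u + ((1 - p.1) * p.2) • v with hγ
  have hAs : ∀ j, ContDiff ℝ ∞ (A j) := fun j => (hA.pol j).1
  have hγs : ContDiff ℝ ∞ γ := by fun_prop
  -- In terms of the pullback of A under γ, f is the dr-coefficient and g is minus the
  -- ds-coefficient, so the divergence of (f, g) is the coefficient of the pullback of dA = B.
  set f : ℝ × ℝ → ℝ := fun p => (1 - p.1) * ∑ j, A j (γ p) * v j with hf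
  set g : ℝ × ℝ → ℝ := fun p => -∑ j, A j (γ p) * (u j - p.2 * v j) with hg
  have hAγ : ∀ j, ContDiff ℝ ∞ fun p => A j (γ p) := fun j => (hAs j).comp hγs
  have hfs : ContDiff ℝ ∞ f :=
    (contDiff_const.sub contDiff_fst).mul (.sum fun j _ => (hAγ j).mul contDiff_const)
  have hgs : ContDiff ℝ ∞ g :=
    (ContDiff.sum fun j _ => (hAγ j).mul
      (contDiff_const.sub (contDiff_snd.mul contDiff_const))).neg
  have hdiv : ∀ p : ℝ × ℝ, fderiv ℝ f p (1, 0) + fderiv ℝ g p (0, 1)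
      = (1 - p.1) * ∑ l, ∑ j, B l j (γ p) * u l * v j := by
    intro p
    have hγ1 : HasDerivAt (fun s => γ (s, p.2)) (u - p.2 • v) p.1 := by
      have h1 : HasDerivAt (fun s : ℝ => s • u) ((1 : ℝ) • u) p.1 :=
        (hasDerivAt_id p.1).smul_const u
      have h2 : HasDerivAt (fun s : ℝ => ((1 - s) * p.2) • v) ((-1 * p.2) • v) p.1 :=
        ((((hasDerivAt_id p.1).const_sub 1).mul_const p.2).smul_const v)
      have h3 := (h1.const_add a).add h2
      exact h3.congr_deriv (by module)
    have hγ2 : HasDerivAt (fun r => γ (p.1, r)) ((1 - p.1) • v) p.2 := by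
      have h2 : HasDerivAt (fun r : ℝ => ((1 - p.1) * r) • v) (((1 - p.1) * 1) • v) p.2 :=
        (((hasDerivAt_id p.2).const_mul (1 - p.1)).smul_const v)
      exact (h2.const_add (a + p.1 • u)).congr_deriv (by rw [mul_one])
    have hA1 : ∀ j, HasDerivAt (fun s => A j (γ (s, p.2)))
        (fderiv ℝ (A j) (γ p) (u - p.2 • v)) p.1 := fun j =>
      ((hAs j).differentiable (by simp) (γ p)).hasFDerivAt.comp_hasDerivAt (x := p.1) hγ1
    have hA2 : ∀ j, HasDerivAt (fun r => A j (γ (p.1, r)))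
        (fderiv ℝ (A j) (γ p) ((1 - p.1) • v)) p.2 := fun j =>
      ((hAs j).differentiable (by simp) (γ p)).hasFDerivAt.comp_hasDerivAt (x := p.2) hγ2
    have hf1 : HasDerivAt (fun s => f (s, p.2)) (-1 * ∑ j, A j (γ p) * v j
        + (1 - p.1) * ∑ j, fderiv ℝ (A j) (γ p) (u - p.2 • v) * v j) p.1 :=
      ((hasDerivAt_id p.1).const_sub 1).mul
        (HasDerivAt.fun_sum fun j _ => (hA1 j).mul_const (v j))
    have hg1 : HasDerivAt (fun r => g (p.1, r)) (-∑ j,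
        (fderiv ℝ (A j) (γ p) ((1 - p.1) • v) * (u j - p.2 * v j)
          + A j (γ p) * (-(1 * v j)))) p.2 :=
      (HasDerivAt.fun_sum fun j _ => (hA2 j).mul
        (((hasDerivAt_id p.2).mul_const (v j)).const_sub (u j))).neg
    have hf2 : HasDerivAt (fun s => f (s, p.2)) (fderiv ℝ f p (1, 0)) p.1 :=
      HasFDerivAt.comp_hasDerivAt (l := f) (f := fun s => (s, p.2)) p.1
        (hfs.differentiable (by simp) p).hasFDerivAt ((hasDerivAt_id p.1).prodMk (hasDerivAt_const p.1 p.2))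
    have hg2 : HasDerivAt (fun r => g (p.1, r)) (fderiv ℝ g p (0, 1)) p.2 :=
      HasFDerivAt.comp_hasDerivAt (l := g) (f := fun r => (p.1, r)) p.2
        (hgs.differentiable (by simp) p).hasFDerivAt ((hasDerivAt_const p.2 p.1).prodMk (hasDerivAt_id p.2))
    rw [hf2.unique hf1, hg2.unique hg1]
    have h1 : ∑ l, ∑ j, B l j (γ p) * u l * v j
        = ∑ j, (fderiv ℝ (A j) (γ p) u * v j - fderiv ℝ (A j) (γ p) v * u j) := by
      simp only [hA.ext_deriv, partialDeriv, sub_mul, Finset.sum_sub_distrib]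
      congr 1
      · rw [Finset.sum_comm]
        refine Finset.sum_congr rfl fun j _ => ?_
        rw [clm_apply_eq_sum _ u, Finset.sum_mul]
        refine Finset.sum_congr rfl fun l _ => ?_
        rw [smul_eq_mul]; ring
      · refine Finset.sum_congr rfl fun l _ => ?_
        rw [clm_apply_eq_sum _ v, Finset.sum_mul]
        refine Finset.sum_congr rfl fun j _ => ?_
        rw [smul_eq_mul]; ring
    rw [h1]
    simp only [Finset.mul_sum, ← Finset.sum_neg_distrib, ← Finset.sum_add_distrib, map_sub,
      map_smul, smul_eq_mul]
    refine Finset.sum_congr rfl fun j _ => ?_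
    ring
  have hmain := integral2_divergence_prod_of_hasFDerivAt f g (fderiv ℝ f) (fderiv ℝ g) 0 0 1 1
    hfs.continuous.continuousOn hgs.continuous.continuousOn
    (fun p _ => (hfs.differentiable (by simp) p).hasFDerivAt)
    (fun p _ => (hgs.differentiable (by simp) p).hasFDerivAt)
    (((((hfs.continuous_fderiv (by simp)).clm_apply continuous_const).add
      ((hgs.continuous_fderiv (by simp)).clm_apply continuous_const)).continuousOn).integrableOn_compact
      (isCompact_uIcc.prod isCompact_uIcc))
  simp only [hdiv] at hmain
  rw [flux_eq, ← hu, ← hv, hmain]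
  have e1 : ∫ x in (0 : ℝ)..1, g (x, 0) = -circulation A a b := by
    simp [hg, hγ, circulation, hu]
  have e2 : ∫ y in (0 : ℝ)..1, f (1, y) = 0 := by simp [hf]
  have e3 : ∫ y in (0 : ℝ)..1, f (0, y) = circulation A a c := by
    simp [hf, hγ, circulation, hv]
  -- The side r = 1 runs from c to b; the sign in g and the reflection s ↦ 1 - s reverse it.
  have e4 : ∫ x in (0 : ℝ)..1, g (x, 1) = circulation A b c := by
    have h := intervalIntegral.integral_comp_sub_left (a := 0) (b := 1)
      (fun x => g (x, 1)) 1
    simp only [sub_self, sub_zero] at h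
    rw [← h]
    unfold circulation
    congr 1
    ext s
    simp only [hg, hγ, ← Finset.sum_neg_distrib]
    refine Finset.sum_congr rfl fun j _ => ?_
    have h1 : a + (1 - s) • u + ((1 - (1 - s)) * 1) • v = b + s • (c - b) := by
      rw [hu, hv]; module
    have h2 : (c - b) j = -(u j - 1 * v j) := by simp [hu, hv]
    rw [h1, h2]; ring
  rw [e1, e2, e3, e4]
  ring

/-- Polynomially bounded closed 2-forms have polynomially bounded potentials. -/
theorem exists_isPolVectorPotential {B : Fin d → Fin d → Conf d → ℝ}
    (hB : IsPolMagneticField B) : ∃ A, IsPolVectorPotential B A := by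
  -- Integrand of the radial gauge A_j(x) = ∫₀¹ ∑ s x_k B_kj(s x) ds.
  set F : Fin d → Conf d × ℝ → ℝ := fun j p => ∑ k, p.2 * p.1 k * B k j (p.2 • p.1) with hFdef
  have hfst : (fun p : Conf d × ℝ => p.1).HasTemperateGrowth :=
    (ContinuousLinearMap.fst ℝ (Conf d) ℝ).hasTemperateGrowth
  have hsnd : (fun p : Conf d × ℝ => p.2).HasTemperateGrowth :=
    (ContinuousLinearMap.snd ℝ (Conf d) ℝ).hasTemperateGrowth
  have hF : ∀ j, (F j).HasTemperateGrowth := fun j => .sum fun k _ =>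
    (hsnd.mul (hasTemperateGrowth_coord hfst k)).mul ((hB.pol k j).comp (hsnd.smul hfst))
  have hBs : ∀ l j, ContDiff ℝ ∞ (B l j) := fun l j => (hB.pol l j).1
  refine ⟨fun j x => ∫ s in (0 : ℝ)..1, F j (x, s),
    fun j => hasTemperateGrowth_unitIntervalIntegral (hF j), fun l j x => ?_⟩
  have hFl : ∀ (l j : Fin d) (s : ℝ), fderiv ℝ (F j) (x, s) (EuclideanSpace.single l 1, 0)
      = s * B l j (s • x) + ∑ k, s * x k * (s * partialDeriv l (B k j) (s • x)) := by
    intro l j s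
    set e : Conf d := EuclideanSpace.single l 1 with he
    have hline : HasDerivAt (fun t : ℝ => x + t • e) e 0 := by
      simpa using ((hasDerivAt_id (0 : ℝ)).smul_const e).const_add x
    have h1 : HasDerivAt (fun t : ℝ => F j (x + t • e, s)) (fderiv ℝ (F j) (x, s) (e, 0)) 0 := by
      have h2 : HasFDerivAt (F j) (fderiv ℝ (F j) (x, s)) (x + (0 : ℝ) • e, s) := by
        simpa using ((hF j).1.differentiable (by simp) (x, s)).hasFDerivAt
      exact h2.comp_hasDerivAt (x := (0 : ℝ)) (hline.prodMk (hasDerivAt_const (0 : ℝ) s))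
    have h3 : HasDerivAt (fun t : ℝ => F j (x + t • e, s))
        (∑ k, (s * (e k) * B k j (s • (x + (0 : ℝ) • e))
          + s * (x + (0 : ℝ) • e) k * (fderiv ℝ (B k j) (s • x) (s • e)))) 0 := by
      refine HasDerivAt.fun_sum fun k _ => ?_
      have h4 : HasDerivAt (fun t : ℝ => (x + t • e) k) (e k) 0 := by
        simpa using ((hasDerivAt_id (0 : ℝ)).mul_const (e k)).const_add (x k)
      have h5 : HasFDerivAt (B k j) (fderiv ℝ (B k j) (s • x)) (s • (x + (0 : ℝ) • e)) := by
        simpa using ((hBs k j).differentiable (by simp) (s • x)).hasFDerivAt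
      exact (h4.const_mul s).mul (h5.comp_hasDerivAt (x := (0 : ℝ)) (hline.const_smul s))
    rw [h1.unique h3, Finset.sum_add_distrib]
    congr 1
    · rw [Finset.sum_eq_single l]
      · simp [he]
      · intro k _ hk
        simp [he, hk]
      · simp
    · refine Finset.sum_congr rfl fun k _ => ?_
      simp [partialDeriv, he]
  have hpd : ∀ l j : Fin d, partialDeriv l (fun x => ∫ s in (0 : ℝ)..1, F j (x, s)) x
      = ∫ s in (0 : ℝ)..1, fderiv ℝ (F j) (x, s) (EuclideanSpace.single l 1, 0) := by
    intro l j
    have hc : Continuous fun s : ℝ => (fderiv ℝ (F j) (x, s)).comp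
        (ContinuousLinearMap.inl ℝ (Conf d) ℝ) :=
      (((hF j).1.continuous_fderiv (by simp)).comp (Continuous.prodMk_right x)).clm_comp
        continuous_const
    rw [partialDeriv, (hasFDerivAt_unitIntervalIntegral (hF j) x).fderiv,
      ContinuousLinearMap.intervalIntegral_apply (hc.intervalIntegrable _ _)]
    simp
  have hci : ∀ l j : Fin d, IntervalIntegrable
      (fun s => fderiv ℝ (F j) (x, s) (EuclideanSpace.single l 1, 0)) volume 0 1 := fun l j =>
    ((((hF j).1.continuous_fderiv (by simp)).comp (Continuous.prodMk_right x)).clm_apply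
      continuous_const).intervalIntegrable _ _
  have hBd : ∀ s : ℝ, HasDerivAt (fun s : ℝ => s ^ 2 * B l j (s • x))
      (2 * s * B l j (s • x) + s ^ 2 * fderiv ℝ (B l j) (s • x) x) s := by
    intro s
    have h1 : HasDerivAt (fun s : ℝ => B l j (s • x)) (fderiv ℝ (B l j) (s • x) ((1 : ℝ) • x)) s :=
      ((hBs l j).differentiable (by simp) (s • x)).hasFDerivAt.comp_hasDerivAt (x := s)
        ((hasDerivAt_id s).smul_const x)
    have h2 := (hasDerivAt_pow 2 s).mul h1
    exact h2.congr_deriv (by simp)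
  -- Closedness combines the derivatives of B into a radial one, so the integrand of dA is d/ds (s²
  -- B_lj(s x)), whose integral over [0, 1] is B_lj(x).
  have hint : ∀ s : ℝ, fderiv ℝ (F j) (x, s) (EuclideanSpace.single l 1, 0)
      - fderiv ℝ (F l) (x, s) (EuclideanSpace.single j 1, 0)
      = 2 * s * B l j (s • x) + s ^ 2 * fderiv ℝ (B l j) (s • x) x := by
    intro s
    rw [hFl, hFl, hB.antisymm l j, clm_apply_eq_sum _ x, Finset.mul_sum]
    have h1 : ∀ k, s * x k * (s * partialDeriv l (B k j) (s • x))
        - s * x k * (s * partialDeriv j (B k l) (s • x))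
        = s ^ 2 * x k • fderiv ℝ (B l j) (s • x) (EuclideanSpace.single k 1) := by
      intro k
      have h2 := hB.closed k l j (s • x)
      have h3 : partialDeriv l (B j k) (s • x) = -partialDeriv l (B k j) (s • x) := by
        have : B j k = -B k j := funext fun y => hB.antisymm k j y
        simp [partialDeriv, this, fderiv_neg]
      rw [h3] at h2
      rw [smul_eq_mul]
      change _ = s ^ 2 * (x k * partialDeriv k (B l j) (s • x))
      linear_combination (-(s ^ 2 * x k)) * h2
    rw [← Finset.sum_congr rfl fun k _ => h1 k, Finset.sum_sub_distrib]
    ring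
  rw [hpd, hpd, ← intervalIntegral.integral_sub (hci l j) (hci j l)]
  simp only [hint]
  rw [intervalIntegral.integral_eq_sub_of_hasDerivAt (fun s _ => hBd s)]
  · simp
  · simp only [← hint]
    exact (hci l j).sub (hci j l)

end Gauge

end MagneticWeyl

end

noncomputable section

namespace MagneticWeyl

open scoped ContDiff Topology RealInnerProductSpace

/-! ### Translations with a unimodular weight on L². -/

section WeightedShift

variable {d : ℕ}

theorem norm_exp_neg_I_mul (t : ℝ) : ‖exp (-I * (t : ℂ))‖ = 1 := by
  simp [Complex.norm_exp]

theorem ae_comp_add_right {P : Conf d → Prop} (h : ∀ᵐ q, P q) (x : Conf d) : ∀ᵐ q, P (q + x) :=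
  (measurePreserving_add_right volume x).quasiMeasurePreserving.ae h

theorem aestronglyMeasurable_weightedShift {θ : Conf d → ℝ} (hθ : Continuous θ) (x : Conf d)
    (u : L2 d) :
    AEStronglyMeasurable (fun q => exp (-I * (θ q : ℂ)) * u (q + x)) volume :=
  (by fun_prop : Continuous fun q => exp (-I * (θ q : ℂ))).aestronglyMeasurable.mul
    ((Lp.memLp u).comp_measurePreserving
      (measurePreserving_add_right volume x)).aestronglyMeasurable

theorem memLp_weightedShift {θ : Conf d → ℝ} (hθ : Continuous θ) (x : Conf d) (u : L2 d) :
    MemLp (fun q => exp (-I * (θ q : ℂ)) * u (q + x)) 2 volume :=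
  ((Lp.memLp u).comp_measurePreserving (measurePreserving_add_right volume x)).congr_norm
    (aestronglyMeasurable_weightedShift hθ x u)
    (Filter.Eventually.of_forall fun q => by
      rw [norm_mul, norm_exp_neg_I_mul, one_mul]; rfl)

/-- The isometry `u ↦ e^{-iθ} u(· + x)` of `L²(ℝ^d)`. -/
def weightedShift {θ : Conf d → ℝ} (hθ : Continuous θ) (x : Conf d) : L2 d →ₗᵢ[ℂ] L2 d where
  toFun u := (memLp_weightedShift hθ x u).toLp _
  map_add' u v := by
    refine Lp.ext ?_
    filter_upwards [MemLp.coeFn_toLp (memLp_weightedShift hθ x (u + v)),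
      Lp.coeFn_add ((memLp_weightedShift hθ x u).toLp _) ((memLp_weightedShift hθ x v).toLp _),
      MemLp.coeFn_toLp (memLp_weightedShift hθ x u), MemLp.coeFn_toLp (memLp_weightedShift hθ x v),
      ae_comp_add_right (Lp.coeFn_add u v) x] with q h1 h2 h3 h4 h5
    rw [h1, h2, Pi.add_apply, h3, h4, h5, Pi.add_apply, mul_add]
  map_smul' c u := by
    refine Lp.ext ?_
    filter_upwards [MemLp.coeFn_toLp (memLp_weightedShift hθ x (c • u)),
      Lp.coeFn_smul c ((memLp_weightedShift hθ x u).toLp _),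
      MemLp.coeFn_toLp (memLp_weightedShift hθ x u),
      ae_comp_add_right (Lp.coeFn_smul c u) x] with q h1 h2 h3 h5
    rw [h1, RingHom.id_apply, h2, Pi.smul_apply, h3, h5, Pi.smul_apply, smul_eq_mul, smul_eq_mul]
    ring
  norm_map' u := by
    change ‖(memLp_weightedShift hθ x u).toLp _‖ = ‖u‖
    rw [Lp.norm_toLp, Lp.norm_def, ← eLpNorm_comp_measurePreserving (p := 2)
      (Lp.memLp u).aestronglyMeasurable (measurePreserving_add_right volume x)]
    congr 1
    refine eLpNorm_congr_norm_ae (Filter.Eventually.of_forall fun q => ?_)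
    rw [norm_mul, norm_exp_neg_I_mul, one_mul]; rfl

theorem coeFn_weightedShift {θ : Conf d → ℝ} (hθ : Continuous θ) (x : Conf d) (u : L2 d) :
    (weightedShift hθ x u : Conf d → ℂ) =ᵐ[volume] fun q => exp (-I * (θ q : ℂ)) * u (q + x) :=
  MemLp.coeFn_toLp (memLp_weightedShift hθ x u)

/-- The first shift moves the argument of the second phase to q + x₁, so the composition law is a
cocycle identity for the phases. -/
theorem weightedShift_weightedShift {θ₁ θ₂ θ : Conf d → ℝ} (h₁ : Continuous θ₁)
    (h₂ : Continuous θ₂) (h : Continuous θ) {x₁ x₂ x : Conf d} (hx : x = x₁ + x₂)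
    (hθ : ∀ q, θ₁ q + θ₂ (q + x₁) = θ q) (u : L2 d) :
    weightedShift h₁ x₁ (weightedShift h₂ x₂ u) = weightedShift h x u := by
  refine Lp.ext ?_
  filter_upwards [coeFn_weightedShift h₁ x₁ (weightedShift h₂ x₂ u), coeFn_weightedShift h x u,
    ae_comp_add_right (coeFn_weightedShift h₂ x₂ u) x₁] with q e1 e2 e3
  rw [e1, e2, e3, ← mul_assoc, ← Complex.exp_add, hx, ← hθ, add_assoc]
  congr 2
  push_cast
  ring

theorem weightedShift_zero {θ : Conf d → ℝ} (h : Continuous θ) {x : Conf d} (hx : x = 0)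
    (hθ : ∀ q, θ q = 0) (u : L2 d) : weightedShift h x u = u := by
  refine Lp.ext ?_
  subst hx
  filter_upwards [coeFn_weightedShift h 0 u] with q e
  rw [e, hθ, add_zero]
  simp

end WeightedShift

/-! ### The phase of the magnetic Weyl operators. -/

section WeylPhase

variable {d : ℕ} {A : Fin d → Conf d → ℝ}

/-- With t as the upper limit, additivity of intervals and the fundamental theorem of calculus apply
along the ray. -/
theorem circulation_smul (A : Fin d → Conf d → ℝ) (q x : Conf d) (t : ℝ) :
    circulation A q (q + t • x) = ∫ r in (0 : ℝ)..t, ∑ j, A j (q + r • x) * x j := by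
  have h := intervalIntegral.mul_integral_comp_mul_left (a := 0) (b := 1)
    (f := fun r => ∑ j, A j (q + r • x) * x j) t
  simp only [mul_zero, mul_one] at h
  rw [← h, ← intervalIntegral.integral_const_mul]
  unfold circulation
  congr 1
  ext s
  rw [Finset.mul_sum]
  refine Finset.sum_congr rfl fun j _ => ?_
  rw [add_sub_cancel_left, smul_smul, mul_comm s t]
  simp
  ring

/-- The phase of the magnetic Weyl operator:
`(e^{-iσ(X,(Q,P^A))} u)(q) = e^{-i weylPhase A X q} u(q + x)`. -/
def weylPhase (A : Fin d → Conf d → ℝ) (X : Phase d) (q : Conf d) : ℝ :=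
  ⟪X.2, q⟫ + ⟪X.2, X.1⟫ / 2 + circulation A q (q + X.1)

/-- The potential `⟪ξ, q⟫ + ∑ x_j A_j(q)` in the Weyl Hamiltonian. -/
def weylPotential (A : Fin d → Conf d → ℝ) (X : Phase d) (q : Conf d) : ℝ :=
  ⟪X.2, q⟫ + ∑ j, A j q * X.1 j

variable (hA : ∀ j, (A j).HasTemperateGrowth)
include hA

theorem weylPotential_hasTemperateGrowth (X : Phase d) :
    (weylPotential A X).HasTemperateGrowth :=
  (Function.hasTemperateGrowth_inner_right X.2).add (.sum fun j _ => (hA j).mul (.const _))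

theorem weylPhase_hasTemperateGrowth (X : Phase d) : (weylPhase A X).HasTemperateGrowth :=
  ((Function.hasTemperateGrowth_inner_right X.2).add (.const _)).add
    (hasTemperateGrowth_circulation hA .id' (Function.HasTemperateGrowth.id'.add (.const X.1)))

theorem continuous_circulation : Continuous fun p : Conf d × Conf d => circulation A p.1 p.2 :=
  (hasTemperateGrowth_circulation hA (ContinuousLinearMap.fst ℝ (Conf d) (Conf d)).hasTemperateGrowth
    (ContinuousLinearMap.snd ℝ (Conf d) (Conf d)).hasTemperateGrowth).1.continuous

theorem continuous_weylPhase_uncurry :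
    Continuous fun p : Phase d × Conf d => weylPhase A p.1 p.2 := by
  unfold weylPhase
  have := (continuous_circulation hA).comp
    (by fun_prop : Continuous fun p : Phase d × Conf d => (p.2, p.2 + p.1.1))
  have h2 : Continuous fun p : Phase d × Conf d => circulation A p.2 (p.2 + p.1.1) := this
  fun_prop

theorem continuous_weylPhase (X : Phase d) : Continuous (weylPhase A X) :=
  (weylPhase_hasTemperateGrowth hA X).1.continuous

theorem continuous_sum_mul (q x : Conf d) : Continuous fun r : ℝ => ∑ j, A j (q + r • x) * x j :=
  continuous_finsetSum _ fun j _ =>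
    ((hA j).1.continuous.comp (by fun_prop)).mul continuous_const

/-- The cocycle identity behind the group law. The circulations along consecutive segments add up,
and the shift in ⟪tξ, q + s x⟫ supplies the cross term st⟪ξ, x⟫ that completes s²/2 + t²/2 to (s +
t)²/2. -/
theorem weylPhase_add_smul (X : Phase d) (s t : ℝ) (q : Conf d) :
    weylPhase A (s • X) q + weylPhase A (t • X) (q + s • X.1) = weylPhase A ((s + t) • X) q := by
  simp only [weylPhase, Prod.smul_fst, Prod.smul_snd, circulation_smul]
  have h1 : ∫ r in (0 : ℝ)..t, ∑ j, A j (q + s • X.1 + r • X.1) * X.1 j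
      = ∫ r in s..(s + t), ∑ j, A j (q + r • X.1) * X.1 j := by
    have h := intervalIntegral.integral_comp_add_left (a := 0) (b := t)
      (fun r => ∑ j, A j (q + r • X.1) * X.1 j) s
    rw [add_zero] at h
    rw [← h]
    congr 1
    ext r
    simp only [add_smul, add_assoc]
  rw [h1]
  have h2 := intervalIntegral.integral_add_adjacent_intervals
    ((continuous_sum_mul hA q X.1).intervalIntegrable 0 s)
    ((continuous_sum_mul hA q X.1).intervalIntegrable (μ := volume) s (s + t))
  rw [← h2]
  simp only [inner_smul_left, inner_smul_right, inner_add_right, conj_trivial]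
  ring

theorem hasDerivAt_weylPhase (X : Phase d) (q : Conf d) (t : ℝ) :
    HasDerivAt (fun t : ℝ => weylPhase A (t • X) q) (weylPotential A X (q + t • X.1)) t := by
  simp only [weylPhase, Prod.smul_fst, Prod.smul_snd, circulation_smul]
  have h1 : HasDerivAt (fun t : ℝ => ∫ r in (0 : ℝ)..t, ∑ j, A j (q + r • X.1) * X.1 j)
      (∑ j, A j (q + t • X.1) * X.1 j) t :=
    (continuous_sum_mul hA q X.1).integral_hasStrictDerivAt 0 t |>.hasDerivAt
  have h2 : HasDerivAt (fun t : ℝ => ⟪t • X.2, q⟫ + ⟪t • X.2, t • X.1⟫ / 2)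
      (⟪X.2, q⟫ + t * ⟪X.2, X.1⟫) t := by
    have h3 : (fun t : ℝ => ⟪t • X.2, q⟫ + ⟪t • X.2, t • X.1⟫ / 2)
        = fun t : ℝ => t * ⟪X.2, q⟫ + t ^ 2 * (⟪X.2, X.1⟫ / 2) := by
      ext t
      simp only [inner_smul_left, inner_smul_right, conj_trivial]
      ring
    rw [h3]
    refine (((hasDerivAt_id t).mul_const _).add ((hasDerivAt_pow 2 t).mul_const _)).congr_deriv ?_
    norm_num
    ring
  refine (h2.add h1).congr_deriv ?_
  simp only [weylPotential, inner_add_right, inner_smul_right]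

end WeylPhase

/-! ### Explicit Weyl operators and their Hamiltonian. -/

section WeylOperator

variable {d : ℕ} {A : Fin d → Conf d → ℝ} (hA : ∀ j, (A j).HasTemperateGrowth)

/-- The magnetic Weyl operator as an isometry. -/
def weylIsometry (X : Phase d) : L2 d →ₗᵢ[ℂ] L2 d :=
  weightedShift (continuous_weylPhase hA X) X.1

theorem weylIsometry_add (X : Phase d) (s t : ℝ) (u : L2 d) :
    weylIsometry hA ((s + t) • X) u = weylIsometry hA (s • X) (weylIsometry hA (t • X) u) :=
  (weightedShift_weightedShift (continuous_weylPhase hA (s • X)) (continuous_weylPhase hA (t • X))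
    (continuous_weylPhase hA ((s + t) • X)) (by simp [add_smul])
    (fun q => weylPhase_add_smul hA X s t q) u).symm

theorem weylIsometry_zero (u : L2 d) : weylIsometry hA 0 u = u := by
  refine weightedShift_zero _ rfl (fun q => ?_) u
  simp [weylPhase, circulation]

theorem weylIsometry_surjective (X : Phase d) : Function.Surjective (weylIsometry hA X) := by
  intro u
  refine ⟨weylIsometry hA ((-1 : ℝ) • X) u, ?_⟩
  have h := weylIsometry_add hA X 1 (-1) u
  rw [one_smul] at h
  rw [← h, add_neg_cancel, zero_smul, weylIsometry_zero]

/-- The magnetic Weyl operator `u ↦ e^{-i weylPhase A X} u(· + x)` as a unitary operator. -/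
def weylUnitary (X : Phase d) : L2 d ≃ₗᵢ[ℂ] L2 d :=
  LinearIsometryEquiv.ofSurjective (weylIsometry hA X) (weylIsometry_surjective hA X)

theorem weylUnitary_apply (X : Phase d) (u : L2 d) :
    weylUnitary hA X u = weylIsometry hA X u := rfl

theorem coeFn_weylUnitary (X : Phase d) (u : L2 d) : (weylUnitary hA X u : Conf d → ℂ)
    =ᵐ[volume] fun q => exp (-I * (weylPhase A X q : ℂ)) * u (q + X.1) :=
  coeFn_weightedShift (continuous_weylPhase hA X) X.1 u

/-- The action of the magnetic Weyl operator on Schwartz functions. -/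
def weylSchwartz (A : Fin d → Conf d → ℝ) (X : Phase d) (u : 𝓢(Conf d, ℂ)) : 𝓢(Conf d, ℂ) :=
  SchwartzMap.smulLeftCLM ℂ (fun q => exp (-I * (weylPhase A X q : ℂ)))
    (SchwartzMap.compSubConstCLM ℂ (-X.1) u)

include hA in
theorem weylSchwartz_apply (X : Phase d) (u : 𝓢(Conf d, ℂ)) (q : Conf d) :
    weylSchwartz A X u q = exp (-I * (weylPhase A X q : ℂ)) * u (q + X.1) := by
  rw [weylSchwartz, SchwartzMap.smulLeftCLM_apply_apply
    (hasTemperateGrowth_expNegI (weylPhase_hasTemperateGrowth hA X)),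
    SchwartzMap.compSubConstCLM_apply, sub_neg_eq_add, smul_eq_mul]

theorem weylUnitary_toLp (X : Phase d) (u : 𝓢(Conf d, ℂ)) :
    weylUnitary hA X (u.toLp 2) = (weylSchwartz A X u).toLp 2 := by
  refine Lp.ext ?_
  filter_upwards [coeFn_weylUnitary hA X (u.toLp 2), (weylSchwartz A X u).coeFn_toLp 2 volume,
    ae_comp_add_right (u.coeFn_toLp 2 volume) X.1] with q h1 h2 h3
  rw [h1, h2, h3, weylSchwartz_apply hA]

/-- The Weyl Hamiltonian applied to a Schwartz function. -/
def hamiltonianSchwartz (A : Fin d → Conf d → ℝ) (X : Phase d) (u : 𝓢(Conf d, ℂ)) :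
    𝓢(Conf d, ℂ) :=
  SchwartzMap.smulLeftCLM ℂ (fun q => (weylPotential A X q : ℂ)) u
    + I • SchwartzMap.evalCLM ℂ (Conf d) ℂ X.1 (SchwartzMap.fderivCLM ℂ (Conf d) ℂ u)

include hA in
theorem hamiltonianSchwartz_apply (X : Phase d) (u : 𝓢(Conf d, ℂ)) (q : Conf d) :
    hamiltonianSchwartz A X u q
      = (weylPotential A X q : ℂ) * u q + I * fderiv ℝ u q X.1 := by
  have h : (fun q => (weylPotential A X q : ℂ)).HasTemperateGrowth :=
    hasTemperateGrowth_clm_comp Complex.ofRealCLM (weylPotential_hasTemperateGrowth hA X)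
  simp [hamiltonianSchwartz, SchwartzMap.smulLeftCLM_apply_apply h]

include hA in
theorem weylHamiltonian_eq (X : Phase d) (u : 𝓢(Conf d, ℂ)) :
    weylHamiltonian A X u = hamiltonianSchwartz A X u := by
  ext q
  rw [hamiltonianSchwartz_apply hA, clm_apply_eq_sum _ X.1, weylHamiltonian, weylPotential]
  simp only [mul_sub, Finset.sum_sub_distrib, Finset.mul_sum, ofReal_add, ofReal_sum, ofReal_mul,
    add_mul, Finset.sum_mul, Complex.real_smul]
  rw [sub_sub_eq_add_sub]
  have h1 : ∀ j, I * ((X.1 j : ℂ) * fderiv ℝ u q (EuclideanSpace.single j 1))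
      = -((X.1 j : ℂ) * (-I * fderiv ℝ u q (EuclideanSpace.single j 1))) := fun j => by ring
  have h2 : ∀ j, (A j q : ℂ) * (X.1 j : ℂ) * u q = (X.1 j : ℂ) * ((A j q : ℂ) * u q) :=
    fun j => by ring
  simp only [h1, h2, Finset.sum_neg_distrib]
  ring

end WeylOperator

/-! ### Strong continuity of the Weyl system. -/

section StrongContinuity

variable {d : ℕ}

/-- From 1 + ‖q‖ ≤ (1 + R)(1 + ‖q + a‖), translates by bounded vectors share one dominating
function. -/
theorem exists_norm_add_le {E F : Type*} [NormedAddCommGroup E] [NormedSpace ℝ E]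
    [NormedAddCommGroup F] [NormedSpace ℝ F] (u : 𝓢(E, F)) (R : ℝ) (hR : 0 ≤ R) (N : ℕ) :
    ∃ C, 0 ≤ C ∧ ∀ q a, ‖a‖ ≤ R → ‖u (q + a)‖ ≤ C * ((1 + ‖q‖) ^ N)⁻¹ := by
  obtain ⟨C, hC0, hC⟩ := exists_norm_le u N
  refine ⟨(1 + R) ^ N * C, by positivity, fun q a ha => ?_⟩
  rw [← div_eq_mul_inv, le_div_iff₀ (by positivity), mul_comm]
  have h1 : 1 + ‖q‖ ≤ (1 + R) * (1 + ‖q + a‖) := by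
    have h2 : ‖q‖ ≤ ‖q + a‖ + ‖a‖ := by simpa using norm_sub_le (q + a) a
    nlinarith [norm_nonneg (q + a)]
  calc (1 + ‖q‖) ^ N * ‖u (q + a)‖ ≤ ((1 + R) * (1 + ‖q + a‖)) ^ N * ‖u (q + a)‖ := by gcongr
    _ = (1 + R) ^ N * ((1 + ‖q + a‖) ^ N * ‖u (q + a)‖) := by rw [mul_pow, mul_assoc]
    _ ≤ (1 + R) ^ N * C := by gcongr; exact hC _

/-- Dominated convergence in `L²` for Schwartz functions. -/
theorem tendsto_toLp_of_dominated {ι : Type*} {l : Filter ι} [l.IsCountablyGenerated]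
    {F : ι → 𝓢(Conf d, ℂ)} {f : 𝓢(Conf d, ℂ)} {C : ℝ}
    (hF : ∀ᶠ i in l, ∀ q, ‖F i q‖ ≤ C * ((1 + ‖q‖) ^ (Module.finrank ℝ (Conf d) + 1))⁻¹)
    (hf : ∀ q, ‖f q‖ ≤ C * ((1 + ‖q‖) ^ (Module.finrank ℝ (Conf d) + 1))⁻¹)
    (hlim : ∀ q, Filter.Tendsto (fun i => F i q) l (𝓝 (f q))) :
    Filter.Tendsto (fun i => (F i).toLp 2 volume) l (𝓝 (f.toLp 2 volume)) := by
  set N := Module.finrank ℝ (Conf d) + 1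
  rw [tendsto_iff_norm_sub_tendsto_zero]
  have h1 : ∀ i, ‖(F i).toLp 2 volume - f.toLp 2 volume‖
      = (∫ q, ‖F i q - f q‖ ^ (2 : ℝ)) ^ (2 : ℝ)⁻¹ := by
    intro i
    have h2 : (F i).toLp 2 volume - f.toLp 2 volume = (F i - f).toLp 2 volume := rfl
    rw [h2, SchwartzMap.norm_toLp' (by norm_num) (by norm_num)]
    simp
  simp only [h1]
  have hlim0 : Filter.Tendsto (fun i => ∫ q, ‖F i q - f q‖ ^ (2 : ℝ)) l
      (𝓝 (∫ _ : Conf d, (0 : ℝ))) := by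
    refine tendsto_integral_filter_of_dominated_convergence
      (fun q => (2 * C) ^ 2 * ((1 + ‖q‖) ^ N)⁻¹) ?_ ?_ ?_ ?_
    · refine Filter.Eventually.of_forall fun i => Continuous.aestronglyMeasurable ?_
      exact (((F i).continuous.sub f.continuous).norm).rpow_const fun _ => Or.inr (by norm_num)
    · filter_upwards [hF] with i hi
      refine Filter.Eventually.of_forall fun q => ?_
      have h2 : ‖F i q - f q‖ ≤ 2 * C * ((1 + ‖q‖) ^ N)⁻¹ := by
        refine (norm_sub_le _ _).trans ?_
        linarith [hi q, hf q]
      -- The weight is at most 1, so its square is dominated by the integrable weight itself.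
      have h3 : ((1 + ‖q‖) ^ N)⁻¹ ≤ 1 :=
        inv_le_one_of_one_le₀ (one_le_pow₀ (by linarith [norm_nonneg q]))
      have h4 : 0 ≤ ((1 + ‖q‖) ^ N)⁻¹ := by positivity
      rw [Real.norm_of_nonneg (by positivity), Real.rpow_two]
      calc ‖F i q - f q‖ ^ 2 ≤ (2 * C * ((1 + ‖q‖) ^ N)⁻¹) ^ 2 := by gcongr
        _ = (2 * C) ^ 2 * (((1 + ‖q‖) ^ N)⁻¹ * ((1 + ‖q‖) ^ N)⁻¹) := by ring
        _ ≤ (2 * C) ^ 2 * (((1 + ‖q‖) ^ N)⁻¹ * 1) := by gcongr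
        _ = _ := by ring
    · exact (integrable_inv_one_add_norm_pow volume (Nat.lt_succ_self _)).const_mul _
    · refine Filter.Eventually.of_forall fun q => ?_
      have h2 := ((hlim q).sub_const (f q)).norm.rpow_const (p := 2) (Or.inr (by norm_num))
      simpa using h2
  simpa using hlim0.rpow_const (p := (2 : ℝ)⁻¹) (Or.inr (by norm_num))

variable {A : Fin d → Conf d → ℝ} (hA : ∀ j, (A j).HasTemperateGrowth)

theorem continuous_weylUnitary_toLp (u : 𝓢(Conf d, ℂ)) :
    Continuous fun X => weylUnitary hA X (u.toLp 2) := by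
  simp only [weylUnitary_toLp]
  refine continuous_iff_continuousAt.2 fun X => ?_
  obtain ⟨C, hC0, hC⟩ := exists_norm_add_le u (‖X‖ + 1) (by positivity)
    (Module.finrank ℝ (Conf d) + 1)
  have hb : ∀ Y : Phase d, ‖Y‖ ≤ ‖X‖ + 1 → ∀ q, ‖weylSchwartz A Y u q‖
      ≤ C * ((1 + ‖q‖) ^ (Module.finrank ℝ (Conf d) + 1))⁻¹ := fun Y hY q => by
    rw [weylSchwartz_apply hA, norm_mul, norm_exp_neg_I_mul, one_mul]
    exact hC q Y.1 ((norm_fst_le Y).trans hY)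
  refine tendsto_toLp_of_dominated (C := C) ?_ (hb X (by linarith)) fun q => ?_
  · have h1 : ∀ᶠ Y in 𝓝 X, ‖Y‖ < ‖X‖ + 1 := continuous_norm.continuousAt.eventually_lt
      continuousAt_const (by simp)
    filter_upwards [h1] with Y hY using hb Y hY.le
  · simp only [weylSchwartz_apply hA]
    have h1 : Continuous fun Y : Phase d => weylPhase A Y q :=
      (continuous_weylPhase_uncurry hA).comp (by fun_prop : Continuous fun Y : Phase d => (Y, q))
    have h2 : Continuous fun Y : Phase d => u (q + Y.1) := u.continuous.comp (by fun_prop)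
    exact (by fun_prop : Continuous fun Y : Phase d =>
      exp (-I * (weylPhase A Y q : ℂ)) * u (q + Y.1)).tendsto X

theorem exists_toLp_dist_lt (u : L2 d) {ε : ℝ} (hε : 0 < ε) :
    ∃ v : 𝓢(Conf d, ℂ), dist u (v.toLp 2) < ε :=
  (SchwartzMap.denseRange_toLpCLM (F := ℂ) (p := 2) (μ := (volume : Measure (Conf d)))
    ENNReal.ofNat_ne_top).exists_dist_lt u hε

/-- The magnetic Weyl system is strongly continuous. -/
theorem continuous_weylUnitary (u : L2 d) : Continuous fun X => weylUnitary hA X u := by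
  refine continuous_of_uniform_approx_of_continuous fun s hs => ?_
  obtain ⟨ε, hε, hs⟩ := Metric.mem_uniformity_dist.1 hs
  obtain ⟨v, hv⟩ := exists_toLp_dist_lt u hε
  refine ⟨_, continuous_weylUnitary_toLp hA v, fun X => hs ?_⟩
  rwa [LinearIsometryEquiv.dist_map]

end StrongContinuity

/-! ### Generator of the explicit group and uniqueness of the Weyl operator. -/

section Uniqueness

variable {d : ℕ} {A : Fin d → Conf d → ℝ} (hA : ∀ j, (A j).HasTemperateGrowth)

include hA in
-- The transport equation, solved along the line q + tx; the derivative is known at every t so that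
-- the mean value inequality can be used.
theorem hasDerivAt_weylSchwartz (X : Phase d) (u : 𝓢(Conf d, ℂ)) (q : Conf d) (t : ℝ) :
    HasDerivAt (fun t : ℝ => weylSchwartz A (t • X) u q)
      (-I * (exp (-I * (weylPhase A (t • X) q : ℂ)) * hamiltonianSchwartz A X u (q + t • X.1)))
      t := by
  simp only [weylSchwartz_apply hA]
  have h1 : HasDerivAt (fun t : ℝ => exp (-I * (weylPhase A (t • X) q : ℂ)))
      (exp (-I * (weylPhase A (t • X) q : ℂ)) * (-I * (weylPotential A X (q + t • X.1) : ℂ))) t :=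
    ((hasDerivAt_weylPhase hA X q t).ofReal_comp.const_mul (-I)).cexp
  have h2 : HasDerivAt (fun t : ℝ => u (q + (t • X).1)) (fderiv ℝ u (q + t • X.1) ((1 : ℝ) • X.1))
      t := HasFDerivAt.comp_hasDerivAt (l := u) (f := fun t : ℝ => q + t • X.1) t
        u.differentiableAt.hasFDerivAt (((hasDerivAt_id t).smul_const X.1).const_add q)
  refine (h1.mul h2).congr_deriv ?_
  rw [hamiltonianSchwartz_apply hA, one_smul, Prod.smul_fst]
  linear_combination (exp (-I * (weylPhase A (t • X) q : ℂ)) *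
    fderiv ℝ u (q + t • X.1) X.1) * I_mul_I

/-- The pointwise derivative is upgraded to an L² derivative: for |t| ≤ 1 the mean value inequality
bounds the difference quotient by the shifted decay of the Hamiltonian applied to u, and dominated
convergence applies. -/
theorem hasDerivAt_weylUnitary (X : Phase d) (u : 𝓢(Conf d, ℂ)) :
    HasDerivAt (fun t : ℝ => weylUnitary hA (t • X) (u.toLp 2))
      (-I • (hamiltonianSchwartz A X u).toLp 2 volume) 0 := by
  rw [hasDerivAt_iff_tendsto_slope_zero]
  obtain ⟨C, hC0, hC⟩ := exists_norm_add_le (hamiltonianSchwartz A X u) ‖X.1‖ (norm_nonneg _)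
    (Module.finrank ℝ (Conf d) + 1)
  have h0 : weylUnitary hA ((0 : ℝ) • X) (u.toLp 2) = u.toLp 2 := by
    rw [zero_smul, weylUnitary_apply, weylIsometry_zero]
  have hw0 : ∀ q, weylSchwartz A ((0 : ℝ) • X) u q = u q := fun q => by
    rw [weylSchwartz_apply hA]
    simp [weylPhase, circulation]
  have heq : ∀ t : ℝ, t⁻¹ • (weylUnitary hA ((0 + t) • X) (u.toLp 2)
      - weylUnitary hA ((0 : ℝ) • X) (u.toLp 2))
      = (t⁻¹ • (weylSchwartz A (t • X) u - u)).toLp 2 := by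
    intro t
    rw [h0, zero_add, weylUnitary_toLp]
    rfl
  simp only [heq]
  have heq2 : -I • (hamiltonianSchwartz A X u).toLp 2 volume
      = (-I • hamiltonianSchwartz A X u).toLp 2 volume := rfl
  rw [heq2]
  refine tendsto_toLp_of_dominated (C := C) ?_ ?_ ?_
  · have h1 : ∀ᶠ t : ℝ in 𝓝[≠] 0, t ∈ Set.Icc (-1 : ℝ) 1 ∧ t ≠ 0 :=
      (eventually_nhdsWithin_of_eventually_nhds (Icc_mem_nhds (by norm_num) (by norm_num))).and
        self_mem_nhdsWithin
    filter_upwards [h1] with t ht q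
    have h2 := (convex_Icc (-1 : ℝ) 1).norm_image_sub_le_of_norm_hasDerivWithin_le
      (f := fun t : ℝ => weylSchwartz A (t • X) u q) (x := 0) (y := t)
      (C := C * ((1 + ‖q‖) ^ (Module.finrank ℝ (Conf d) + 1))⁻¹)
      (fun s _ => (hasDerivAt_weylSchwartz hA X u q s).hasDerivWithinAt) (fun s hs => ?_)
      (by norm_num) ht.1
    · simp only [hw0, sub_zero] at h2
      rw [_root_.smul_apply, _root_.sub_apply, norm_smul, norm_inv, inv_mul_le_iff₀
        (norm_pos_iff.2 ht.2), mul_comm ‖t‖]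
      exact h2
    · rw [norm_mul, norm_mul, norm_exp_neg_I_mul, norm_neg, norm_I, one_mul, one_mul]
      refine hC q (s • X.1) ?_
      rw [norm_smul, Real.norm_eq_abs]
      exact mul_le_of_le_one_left (norm_nonneg _) (abs_le.2 hs)
  · intro q
    rw [_root_.smul_apply, norm_smul, norm_neg, norm_I, one_mul]
    simpa using hC q 0 (by simp)
  · intro q
    have h1 := hasDerivAt_iff_tendsto_slope_zero.1 (hasDerivAt_weylSchwartz hA X u q 0)
    simp only [zero_add, hw0] at h1
    simpa [weylPhase, circulation] using h1

theorem isWeylOperator_weylUnitary (X : Phase d) : IsWeylOperator A X (weylUnitary hA X) := by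
  refine ⟨fun t => weylUnitary hA (t • X), fun s t u => weylIsometry_add hA X s t u,
    fun u => (continuous_weylUnitary hA u).comp (by fun_prop), fun u => ?_, by simp⟩
  simp only [weylHamiltonian_eq hA]
  exact ⟨(hamiltonianSchwartz A X u).memLp 2 volume, hasDerivAt_weylUnitary hA X u⟩

section Comparison

variable {X : Phase d} {U : ℝ → (L2 d ≃ₗᵢ[ℂ] L2 d)} (hadd : ∀ s t u, U (s + t) u = U s (U t u))
include hadd

theorem unitaryGroup_zero (u : L2 d) : U 0 u = u := (U 0).injective (by rw [← hadd, add_zero])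

theorem unitaryGroup_neg (t : ℝ) (u : L2 d) : U (-t) (U t u) = u := by
  rw [← hadd, neg_add_cancel, unitaryGroup_zero hadd]

variable (hder : ∀ w : 𝓢(Conf d, ℂ), HasDerivAt (fun t => U t (w.toLp 2 volume))
  (-I • (hamiltonianSchwartz A X w).toLp 2 volume) 0)
include hder

/-- Since U(-t) is isometric, ‖U(-t) W_t w - w‖ = ‖W_t w - U(t) w‖, which is o(t) because both
groups have the same derivative at 0. -/
theorem hasDerivAt_unitaryGroup_neg_weylUnitary_zero (w : 𝓢(Conf d, ℂ)) :
    HasDerivAt (fun t : ℝ => U (-t) (weylUnitary hA (t • X) (w.toLp 2 volume))) 0 0 := by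
  have h1 := (hasDerivAt_weylUnitary hA X w).sub (hder w)
  rw [sub_self, hasDerivAt_iff_isLittleO] at h1
  rw [hasDerivAt_iff_isLittleO]
  refine Asymptotics.IsLittleO.of_norm_left (h1.norm_left.congr_left fun t => ?_)
  have h2 : weylUnitary hA ((0 : ℝ) • X) (w.toLp 2 volume) = w.toLp 2 volume := by
    rw [zero_smul, weylUnitary_apply, weylIsometry_zero]
  simp only [Pi.sub_apply, h2, unitaryGroup_zero hadd, sub_self, smul_zero, sub_zero, neg_zero]
  generalize weylUnitary hA (t • X) (w.toLp 2 volume) = y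
  generalize w.toLp 2 volume = z
  conv_rhs => rw [← unitaryGroup_neg hadd t z, ← map_sub, LinearIsometryEquiv.norm_map]

/-- W_t preserves Schwartz functions, so with U(-s) W_s w = U(-t) U(-(s-t)) W_{s-t} (W_t w) the
derivative at t reduces to the one at 0 for W_t w. Invariance of the domain replaces any appeal to
essential self-adjointness. -/
theorem hasDerivAt_unitaryGroup_neg_weylUnitary (w : 𝓢(Conf d, ℂ)) (t : ℝ) :
    HasDerivAt (fun t : ℝ => U (-t) (weylUnitary hA (t • X) (w.toLp 2 volume))) 0 t := by
  have h1 := hasDerivAt_unitaryGroup_neg_weylUnitary_zero hA hadd hder (weylSchwartz A (t • X) w)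
  have h2 : HasDerivAt (fun s : ℝ => U (-t) (U (-s) (weylUnitary hA (s • X)
      ((weylSchwartz A (t • X) w).toLp 2 volume)))) (U (-t) 0) (t - t) := by
    rw [sub_self]
    exact ((U (-t)).toContinuousLinearEquiv.toContinuousLinearMap.restrictScalars
      ℝ).hasFDerivAt.comp_hasDerivAt (0 : ℝ) h1
  rw [map_zero] at h2
  refine (h2.comp_sub_const t t).congr_of_eventuallyEq (Filter.Eventually.of_forall fun s => ?_)
  have h3 := weylIsometry_add hA X (s - t) t (w.toLp 2 volume)
  rw [sub_add_cancel] at h3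
  simp only [← weylUnitary_toLp hA, ← hadd, weylUnitary_apply, ← h3, neg_sub,
    neg_add_eq_sub, sub_sub_cancel_left]

theorem unitaryGroup_one_toLp (w : 𝓢(Conf d, ℂ)) :
    U 1 (w.toLp 2 volume) = weylUnitary hA X (w.toLp 2 volume) := by
  have hd := hasDerivAt_unitaryGroup_neg_weylUnitary hA hadd hder w
  have h1 := is_const_of_deriv_eq_zero (fun t => (hd t).differentiableAt)
    (fun t => (hd t).deriv) 1 0
  simp only [one_smul, neg_zero, unitaryGroup_zero hadd, zero_smul, weylUnitary_apply,
    weylIsometry_zero] at h1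
  have h2 := unitaryGroup_neg hadd (-1) (weylIsometry hA X (w.toLp 2 volume))
  rw [neg_neg, h1] at h2
  exact h2

end Comparison

theorem IsWeylOperator.eq_weylUnitary {X : Phase d} {W : L2 d ≃ₗᵢ[ℂ] L2 d}
    (hW : IsWeylOperator A X W) : W = weylUnitary hA X := by
  obtain ⟨U, hadd, -, hder, rfl⟩ := hW
  have hder' : ∀ w : 𝓢(Conf d, ℂ), HasDerivAt (fun t => U t (w.toLp 2 volume))
      (-I • (hamiltonianSchwartz A X w).toLp 2 volume) 0 := fun w => by
    obtain ⟨hu, h⟩ := hder w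
    simp only [weylHamiltonian_eq hA] at hu h
    exact h
  ext1 u
  exact (SchwartzMap.denseRange_toLpCLM (F := ℂ) (p := 2) (μ := (volume : Measure (Conf d)))
    ENNReal.ofNat_ne_top).induction_on (p := fun u => U 1 u = weylUnitary hA X u) u
    (isClosed_eq (U 1).continuous (weylUnitary hA X).continuous)
    fun w => unitaryGroup_one_toLp hA hadd hder' w

/-- The explicit operator shows that the choice is made from a nonempty set, and uniqueness that
this set is a singleton. -/
theorem weylSystem_eq (X : Phase d) : weylSystem A X = weylUnitary hA X :=
  IsWeylOperator.eq_weylUnitary hA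
    (Classical.epsilon_spec (p := IsWeylOperator A X) ⟨_, isWeylOperator_weylUnitary hA X⟩)

end Uniqueness

end MagneticWeyl

end

noncomputable section

namespace MagneticWeyl

open scoped ContDiff Topology RealInnerProductSpace

/-! ### Integral operators with decaying continuous kernels. -/

section DecayingKernel

variable {d : ℕ}

/-- The weight `(1 + ‖q‖)^{-(d+1)}`. -/
def decayWeight (q : Conf d) : ℝ := ((1 + ‖q‖) ^ (Module.finrank ℝ (Conf d) + 1))⁻¹

theorem decayWeight_nonneg (q : Conf d) : 0 ≤ decayWeight q := by
  unfold decayWeight; positivity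

theorem decayWeight_le_one (q : Conf d) : decayWeight q ≤ 1 :=
  inv_le_one_of_one_le₀ (one_le_pow₀ (by linarith [norm_nonneg q]))

theorem integrable_decayWeight : Integrable (decayWeight : Conf d → ℝ) :=
  integrable_inv_one_add_norm_pow volume (Nat.lt_succ_self _)

theorem integrable_norm_sq (u : L2 d) : Integrable fun q => ‖u q‖ ^ 2 :=
  (memLp_two_iff_integrable_sq_norm (Lp.memLp u).aestronglyMeasurable).1 (Lp.memLp u)

/-- With ρ the weight, ρ‖u‖ ≤ ρ² + ‖u‖² ≤ ρ + ‖u‖², as 0 ≤ ρ ≤ 1. -/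
theorem integrable_decayWeight_mul_norm (u : L2 d) :
    Integrable fun q => decayWeight q * ‖u q‖ := by
  refine (integrable_decayWeight.add (integrable_norm_sq u)).mono'
    (integrable_decayWeight.aestronglyMeasurable.mul (Lp.memLp u).aestronglyMeasurable.norm)
    (Filter.Eventually.of_forall fun q => ?_)
  have h1 := decayWeight_nonneg q
  have h2 := decayWeight_le_one q
  rw [Real.norm_of_nonneg (by positivity), Pi.add_apply]
  nlinarith [sq_nonneg (decayWeight q - ‖u q‖), norm_nonneg (u q)]

theorem memLp_two_of_norm_le {φ : Conf d → ℂ} (hφ : Continuous φ) {C : ℝ}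
    (h : ∀ q, ‖φ q‖ ≤ C * decayWeight q) : MemLp φ 2 volume := by
  refine (memLp_two_iff_integrable_sq_norm hφ.aestronglyMeasurable).2 ?_
  refine (integrable_decayWeight.const_mul (C ^ 2)).mono' (by fun_prop)
    (Filter.Eventually.of_forall fun q => ?_)
  have h1 := decayWeight_nonneg q
  have h2 := decayWeight_le_one q
  rw [Real.norm_of_nonneg (by positivity)]
  calc ‖φ q‖ ^ 2 ≤ (C * decayWeight q) ^ 2 := by gcongr; exact h q
    _ = C ^ 2 * (decayWeight q * decayWeight q) := by ring
    _ ≤ C ^ 2 * (decayWeight q * 1) := by gcongr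
    _ = _ := by ring

/-- Continuous integral kernels on `ℝ^d × ℝ^d` that decay integrably in both variables. -/
structure IsDecayingKernel (K : Conf d → Conf d → ℂ) : Prop where
  continuous : Continuous fun p : Conf d × Conf d => K p.1 p.2
  decay : ∃ C, 0 ≤ C ∧ ∀ q p, ‖K q p‖ ≤ C * decayWeight q * decayWeight p

namespace IsDecayingKernel

variable {K K₁ K₂ : Conf d → Conf d → ℂ}

theorem continuous_right (hK : IsDecayingKernel K) (q : Conf d) : Continuous (K q) :=
  hK.continuous.comp (by fun_prop : Continuous fun p : Conf d => (q, p))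

theorem continuous_left (hK : IsDecayingKernel K) (p : Conf d) : Continuous fun q => K q p :=
  hK.continuous.comp (by fun_prop : Continuous fun q : Conf d => (q, p))

theorem sub (h₁ : IsDecayingKernel K₁) (h₂ : IsDecayingKernel K₂) :
    IsDecayingKernel fun q p => K₁ q p - K₂ q p := by
  obtain ⟨C₁, hC₁, hb₁⟩ := h₁.decay
  obtain ⟨C₂, hC₂, hb₂⟩ := h₂.decay
  refine ⟨h₁.continuous.sub h₂.continuous, C₁ + C₂, by positivity, fun q p => ?_⟩
  refine (norm_sub_le _ _).trans ?_
  rw [add_mul, add_mul]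
  exact add_le_add (hb₁ q p) (hb₂ q p)

theorem exists_bound (hK : IsDecayingKernel K) :
    ∃ C, 0 ≤ C ∧ ∀ q p, ‖K q p‖ ≤ C * decayWeight p := by
  obtain ⟨C, hC, hb⟩ := hK.decay
  refine ⟨C, hC, fun q p => (hb q p).trans ?_⟩
  have := decayWeight_nonneg p
  have := decayWeight_le_one q
  gcongr
  exact mul_le_of_le_one_right hC this

theorem integrable_mul (hK : IsDecayingKernel K) (u : L2 d) (q : Conf d) :
    Integrable fun p => K q p * u p := by
  obtain ⟨C, hC, hb⟩ := hK.exists_bound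
  refine ((integrable_decayWeight_mul_norm u).const_mul C).mono'
    ((hK.continuous_right q).aestronglyMeasurable.mul (Lp.memLp u).aestronglyMeasurable)
    (Filter.Eventually.of_forall fun p => ?_)
  rw [norm_mul, ← mul_assoc]
  gcongr
  exact hb q p

theorem continuous_integral (hK : IsDecayingKernel K) (u : L2 d) :
    Continuous fun q => ∫ p, K q p * u p := by
  obtain ⟨C, hC, hb⟩ := hK.exists_bound
  refine continuous_of_dominated (bound := fun p => C * (decayWeight p * ‖u p‖))
    (fun q => (hK.integrable_mul u q).aestronglyMeasurable)
    (fun q => Filter.Eventually.of_forall fun p => ?_)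
    ((integrable_decayWeight_mul_norm u).const_mul C)
    (Filter.Eventually.of_forall fun p => (hK.continuous_left p).mul continuous_const)
  rw [norm_mul, ← mul_assoc]
  gcongr
  exact hb q p

theorem memLp_integral (hK : IsDecayingKernel K) (u : L2 d) :
    MemLp (fun q => ∫ p, K q p * u p) 2 volume := by
  obtain ⟨C, hC, hb⟩ := hK.decay
  refine memLp_two_of_norm_le (hK.continuous_integral u)
    (C := C * ∫ p, decayWeight p * ‖u p‖) fun q => ?_
  have h1 : C * (∫ p, decayWeight p * ‖u p‖) * decayWeight q
      = ∫ p, (C * decayWeight q) * (decayWeight p * ‖u p‖) := by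
    rw [integral_const_mul]; ring
  rw [h1]
  refine norm_integral_le_of_norm_le ((integrable_decayWeight_mul_norm u).const_mul _)
    (Filter.Eventually.of_forall fun p => ?_)
  rw [norm_mul, ← mul_assoc]
  gcongr
  exact hb q p

theorem integral_comp (h₁ : IsDecayingKernel K₁) (h₂ : IsDecayingKernel K₂) (u : L2 d)
    (q : Conf d) :
    ∫ p, K₁ q p * ∫ r, K₂ p r * u r = ∫ r, (∫ p, K₁ q p * K₂ p r) * u r := by
  obtain ⟨C₁, hC₁, hb₁⟩ := h₁.exists_bound
  obtain ⟨C₂, hC₂, hb₂⟩ := h₂.exists_bound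
  have hint : Integrable (fun z : Conf d × Conf d => K₁ q z.1 * (K₂ z.1 z.2 * u z.2))
      (volume.prod volume) := by
    refine ((integrable_decayWeight.const_mul C₁).mul_prod
      ((integrable_decayWeight_mul_norm u).const_mul C₂)).mono' ?_
      (Filter.Eventually.of_forall fun z => ?_)
    · exact ((h₁.continuous_right q).comp continuous_fst).aestronglyMeasurable.mul
        (h₂.continuous.aestronglyMeasurable.mul (Lp.memLp u).aestronglyMeasurable.comp_snd)
    · rw [norm_mul, norm_mul, ← mul_assoc C₂]
      have := decayWeight_nonneg z.1
      gcongr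
      · exact hb₁ q z.1
      · exact hb₂ z.1 z.2
  simp only [← integral_const_mul, ← integral_mul_const]
  rw [integral_integral_swap hint]
  simp only [mul_assoc]

/-- Test with u = conj K(q, ·), which lies in L². The image is continuous, so it vanishes at q
itself and not only almost everywhere; there it equals ∫ ‖K(q, p)‖² dp. -/
theorem eq_zero (hK : IsDecayingKernel K)
    (h : ∀ u : L2 d, (fun q => ∫ p, K q p * u p) =ᵐ[volume] 0) (q p : Conf d) : K q p = 0 := by
  obtain ⟨C, hC, hb⟩ := hK.exists_bound
  have hmem : MemLp (fun p => (starRingEnd ℂ) (K q p)) 2 volume :=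
    memLp_two_of_norm_le (Complex.continuous_conj.comp (hK.continuous_right q)) (C := C)
      fun p => by rw [RCLike.norm_conj]; exact hb q p
  have h1 : (fun q => ∫ p, K q p * hmem.toLp _ p) = 0 :=
    (Continuous.ae_eq_iff_eq volume (hK.continuous_integral _) continuous_zero).1 (h _)
  have h2 : ∫ p, ((‖K q p‖ ^ 2 : ℝ) : ℂ) = 0 := by
    have h3 := congr_fun h1 q
    simp only [Pi.zero_apply] at h3
    rw [← h3]
    refine integral_congr_ae ?_
    filter_upwards [hmem.coeFn_toLp] with p hp
    rw [hp, Complex.mul_conj, Complex.normSq_eq_norm_sq]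
  rw [integral_complex_ofReal, ofReal_eq_zero, integral_eq_zero_iff_of_nonneg (fun p => by positivity)] at h2
  · have h3 : (fun p => ‖K q p‖ ^ 2) = fun _ => (0 : ℝ) :=
      (Continuous.ae_eq_iff_eq volume ((hK.continuous_right q).norm.pow 2) continuous_const).1 h2
    have h4 := congr_fun h3 p
    simpa using h4
  · have h5 := (memLp_two_iff_integrable_sq_norm hmem.aestronglyMeasurable).1 hmem
    simpa only [RCLike.norm_conj] using h5

end IsDecayingKernel

end DecayingKernel

/-! ### Fourier transform in the momentum variable and the symplectic Fourier transform. -/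

section MomentumFourier

variable {d : ℕ}

instance isAddHaarMeasure_volume_phase : (volume : Measure (Phase d)).IsAddHaarMeasure :=
  inferInstanceAs ((volume : Measure (Conf d)).prod (volume : Measure (Conf d))).IsAddHaarMeasure

/-- Composition of a Schwartz function with an injective linear map. -/
def compInjective {E F : Type} [NormedAddCommGroup E] [NormedSpace ℝ E] [FiniteDimensional ℝ E]
    [NormedAddCommGroup F] [NormedSpace ℝ F] (L : E →L[ℝ] F) (hL : Function.Injective L)
    (f : 𝓢(F, ℂ)) : 𝓢(E, ℂ) :=
  SchwartzMap.compCLMOfAntilipschitz ℝ L.hasTemperateGrowth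
    (L.toLinearMap.exists_antilipschitzWith (LinearMap.ker_eq_bot.2 hL)).choose_spec.2 f

theorem compInjective_apply {E F : Type} [NormedAddCommGroup E] [NormedSpace ℝ E]
    [FiniteDimensional ℝ E] [NormedAddCommGroup F] [NormedSpace ℝ F] (L : E →L[ℝ] F)
    (hL : Function.Injective L) (f : 𝓢(F, ℂ)) (x : E) : compInjective L hL f x = f (L x) := rfl

/-- The Fourier transform `(m, x) ↦ (2π)^{-d} ∫ e^{-i⟪x, η⟫} f(m, η) dη` in the momentum variable. -/
def momentumFourier (f : 𝓢(Phase d, ℂ)) : 𝓢(Phase d, ℂ) :=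
  (((2 * Real.pi : ℝ) : ℂ)⁻¹ ^ d) • partialFourier f

theorem two_pi_pow_ne_zero : ((2 * Real.pi : ℝ) : ℂ) ^ d ≠ 0 := by
  have : (2 * Real.pi : ℝ) ≠ 0 := by positivity
  exact pow_ne_zero _ (by exact_mod_cast this)

theorem partialFourier_eq_momentumFourier (f : 𝓢(Phase d, ℂ)) (p : Phase d) :
    partialFourier f p = ((2 * Real.pi : ℝ) : ℂ) ^ d * momentumFourier f p := by
  rw [momentumFourier, _root_.smul_apply, smul_eq_mul, ← mul_assoc, inv_pow,
    mul_inv_cancel₀ two_pi_pow_ne_zero, one_mul]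

theorem momentumFourier_apply (f : 𝓢(Phase d, ℂ)) (m x : Conf d) :
    momentumFourier f (m, x)
      = ((2 * Real.pi : ℝ) : ℂ)⁻¹ ^ d * ∫ η, exp (-I * (⟪x, η⟫ : ℂ)) * f (m, η) := by
  rw [momentumFourier, _root_.smul_apply, smul_eq_mul, partialFourier_apply]

theorem eq_integral_momentumFourier (f : 𝓢(Phase d, ℂ)) (m ξ : Conf d) :
    f (m, ξ) = ∫ x, exp (I * (⟪ξ, x⟫ : ℂ)) * momentumFourier f (m, x) := by
  have h := integral_exp_mul_partialFourier f m ξ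
  simp only [partialFourier_eq_momentumFourier, finrank_euclideanSpace_fin, mul_left_comm _
    (((2 * Real.pi : ℝ) : ℂ) ^ d)] at h
  rw [integral_const_mul] at h
  exact (mul_left_cancel₀ two_pi_pow_ne_zero h).symm

theorem momentumFourier_injective : Function.Injective (momentumFourier (d := d)) := by
  intro f g h
  ext ⟨m, ξ⟩
  rw [eq_integral_momentumFourier f, eq_integral_momentumFourier g, h]

/-- The function `(x, ξ) ↦ (x, -ξ)` on phase space. -/
def negSnd : Phase d →L[ℝ] Phase d :=
  (ContinuousLinearMap.fst ℝ _ _).prod (-ContinuousLinearMap.snd ℝ _ _)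

theorem negSnd_injective : Function.Injective (negSnd (d := d)) := by
  rintro ⟨a, b⟩ ⟨a', b'⟩ h
  simpa [negSnd] using h

/-- The inverse of `momentumFourier`. -/
def momentumFourierInv (k : 𝓢(Phase d, ℂ)) : 𝓢(Phase d, ℂ) :=
  compInjective negSnd negSnd_injective (partialFourier k)

theorem momentumFourierInv_eq (k : 𝓢(Phase d, ℂ)) (m ξ : Conf d) :
    momentumFourierInv k (m, ξ) = partialFourier k (m, -ξ) := rfl

theorem momentumFourierInv_apply (k : 𝓢(Phase d, ℂ)) (m ξ : Conf d) :
    momentumFourierInv k (m, ξ) = ∫ x, exp (I * (⟪ξ, x⟫ : ℂ)) * k (m, x) := by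
  rw [momentumFourierInv_eq, partialFourier_apply]
  simp

theorem momentumFourier_momentumFourierInv (k : 𝓢(Phase d, ℂ)) :
    momentumFourier (momentumFourierInv k) = k := by
  ext ⟨m, x⟩
  rw [momentumFourier_apply, inv_pow, inv_mul_eq_iff_eq_mul₀ two_pi_pow_ne_zero]
  have h := integral_exp_mul_partialFourier k m x
  rw [finrank_euclideanSpace_fin] at h
  rw [← h, ← integral_neg_eq_self]
  simp [momentumFourierInv_eq]

/-- Exchanging the two variables of phase space. -/
def swapPhase : Phase d →L[ℝ] Phase d :=
  (ContinuousLinearMap.snd ℝ _ _).prod (ContinuousLinearMap.fst ℝ _ _)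

theorem swapPhase_injective : Function.Injective (swapPhase (d := d)) := by
  rintro ⟨a, b⟩ ⟨a', b'⟩ h
  simpa [swapPhase, and_comm] using h

/-- The function `(x, y) ↦ f (y, x)`. -/
def swapSchwartz (f : 𝓢(Phase d, ℂ)) : 𝓢(Phase d, ℂ) :=
  compInjective swapPhase swapPhase_injective f

theorem swapSchwartz_apply (f : 𝓢(Phase d, ℂ)) (x y : Conf d) :
    swapSchwartz f (x, y) = f (y, x) := rfl

/-- The symplectic Fourier transform as a Schwartz function. -/
def symplecticSchwartz (f : 𝓢(Phase d, ℂ)) : 𝓢(Phase d, ℂ) :=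
  momentumFourierInv (swapSchwartz (momentumFourier f))

/-- As σ(X, X') = ⟪ξ, y⟫ - ⟪x, η⟫, integrating over η first produces the momentum transform at (y,
x), and the integral over y is an inverse momentum transform. -/
theorem symplecticSchwartz_apply (f : 𝓢(Phase d, ℂ)) (X : Phase d) :
    symplecticFourier f X = symplecticSchwartz f X := by
  obtain ⟨x, ξ⟩ := X
  rw [symplecticSchwartz, momentumFourierInv_apply]
  simp only [swapSchwartz_apply, momentumFourier_apply]
  have hint : Integrable (fun X' : Phase d => exp (I * (sigma (x, ξ) X' : ℂ)) * f X')
      (volume.prod volume) := by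
    refine (f.integrable (μ := volume)).norm.mono' (Continuous.aestronglyMeasurable ?_)
      (Filter.Eventually.of_forall fun X' => ?_)
    · unfold sigma
      exact (by fun_prop : Continuous fun X' : Phase d =>
        exp (I * ((inner ℝ ξ X'.1 - inner ℝ x X'.2 : ℝ) : ℂ))).mul f.continuous
    · rw [norm_mul, mul_comm I, Complex.norm_exp_ofReal_mul_I, one_mul]
  rw [symplecticFourier, Measure.volume_eq_prod, integral_prod _ hint, ← integral_const_mul]
  refine integral_congr_ae (Filter.Eventually.of_forall fun y => ?_)
  simp only
  rw [mul_left_comm]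
  congr 1
  rw [← integral_const_mul]
  refine integral_congr_ae (Filter.Eventually.of_forall fun η => ?_)
  simp only [sigma]
  rw [← mul_assoc, ← Complex.exp_add]
  congr 2
  push_cast
  ring

theorem momentumFourier_symplecticSchwartz (f : 𝓢(Phase d, ℂ)) (x m : Conf d) :
    momentumFourier (symplecticSchwartz f) (x, m) = momentumFourier f (m, x) := by
  rw [symplecticSchwartz, momentumFourier_momentumFourierInv, swapSchwartz_apply]

end MomentumFourier

end MagneticWeyl

end

noncomputable section

namespace MagneticWeyl

open scoped ContDiff Topology RealInnerProductSpace

/-! ### The kernel of a magnetic Weyl quantization. -/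

section OperatorKernel

variable {d : ℕ} {A : Fin d → Conf d → ℝ}

/-- The integral kernel of the magnetic Weyl quantization of `h`. -/
def weylKernel (A : Fin d → Conf d → ℝ) (h : 𝓢(Phase d, ℂ)) (q p : Conf d) : ℂ :=
  momentumFourier h ((1 / 2 : ℝ) • (q + p), p - q) * exp (-I * (circulation A q p : ℂ))

/-- The map `(q, p) ↦ ((q + p) / 2, p - q)`. -/
def midpointDiff : Phase d →L[ℝ] Phase d :=
  ((1 / 2 : ℝ) • (ContinuousLinearMap.fst ℝ (Conf d) (Conf d)
    + ContinuousLinearMap.snd ℝ (Conf d) (Conf d))).prod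
    (ContinuousLinearMap.snd ℝ (Conf d) (Conf d) - ContinuousLinearMap.fst ℝ (Conf d) (Conf d))

theorem midpointDiff_apply (q p : Conf d) :
    midpointDiff (q, p) = ((1 / 2 : ℝ) • (q + p), p - q) := rfl

theorem midpointDiff_injective : Function.Injective (midpointDiff (d := d)) := by
  refine (injective_iff_map_eq_zero _).2 ?_
  rintro ⟨q, p⟩ h
  rw [midpointDiff_apply, Prod.mk_eq_zero] at h
  have h1 : q + p = 0 := (smul_eq_zero.1 h.1).resolve_left (by norm_num)
  have h2 : p = q := sub_eq_zero.1 h.2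
  rw [h2, ← two_smul ℝ q] at h1
  have h3 : q = 0 := by simpa using h1
  rw [h2, h3]; rfl

theorem isDecayingKernel_weylKernel (hA : ∀ j, (A j).HasTemperateGrowth) (h : 𝓢(Phase d, ℂ)) :
    IsDecayingKernel (weylKernel A h) := by
  set N := Module.finrank ℝ (Conf d) + 1 with hN
  -- The exponent N + N leaves one weight for each of q and p.
  obtain ⟨C, hC, hb⟩ := exists_norm_le
    (compInjective midpointDiff midpointDiff_injective (momentumFourier h)) (N + N)
  constructor
  · have h1 := continuous_circulation hA
    have h2 : Continuous fun p : Conf d × Conf d =>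
        momentumFourier h ((1 / 2 : ℝ) • (p.1 + p.2), p.2 - p.1) :=
      (momentumFourier h).continuous.comp (by fun_prop)
    unfold weylKernel
    fun_prop
  · refine ⟨C, hC, fun q p => ?_⟩
    rw [weylKernel, norm_mul, norm_exp_neg_I_mul, mul_one, decayWeight, decayWeight, ← hN,
      ← div_eq_mul_inv, ← div_eq_mul_inv, div_div, le_div_iff₀ (by positivity), mul_comm]
    refine le_trans ?_ (hb (q, p))
    rw [compInjective_apply, midpointDiff_apply, pow_add _ N N]
    have h1 : ‖q‖ ≤ ‖(q, p)‖ := norm_fst_le (q, p)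
    have h2 : ‖p‖ ≤ ‖(q, p)‖ := norm_snd_le (q, p)
    gcongr

/-- Guarantees that the Bochner integral in `magneticOp` is a genuine one and not the default value
0. -/
theorem integrable_symplectic_smul_weylUnitary (hA : ∀ j, (A j).HasTemperateGrowth)
    (h : 𝓢(Phase d, ℂ)) (u : L2 d) :
    Integrable fun X => symplecticSchwartz h X • weylUnitary hA X u := by
  refine ((symplecticSchwartz h).integrable.norm.mul_const ‖u‖).mono'
    ((symplecticSchwartz h).continuous.smul (continuous_weylUnitary hA u)).aestronglyMeasurable
    (Filter.Eventually.of_forall fun X => ?_)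
  rw [norm_smul, LinearIsometryEquiv.norm_map]

theorem measurePreserving_shear : MeasurePreserving
    (fun z : Phase d × Conf d => (z.1, z.2 + z.1.1)) (volume.prod volume) (volume.prod volume) :=
  MeasurePreserving.skew_product (f := id) (MeasurePreserving.id (volume : Measure (Phase d)))
    (g := fun (X : Phase d) (q : Conf d) => q + X.1)
    (by unfold Function.uncurry; fun_prop)
    (Filter.Eventually.of_forall fun X => (measurePreserving_add_right volume X.1).map_eq)

/-- By |u||v| ≤ |u|² + |v|² it suffices to treat the two squares separately; a measure-preserving
shear removes the shift in u, leaving products of integrable functions. -/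
theorem integrable_matrixElement (hA : ∀ j, (A j).HasTemperateGrowth) (h : 𝓢(Phase d, ℂ))
    (u v : L2 d) :
    Integrable (fun z : Phase d × Conf d => symplecticSchwartz h z.1 *
      (exp (-I * (weylPhase A z.1 z.2 : ℂ)) * u (z.2 + z.1.1) * (starRingEnd ℂ) (v z.2)))
      (volume.prod volume) := by
  have hF := (symplecticSchwartz h).integrable (μ := volume)
  have h1 : Integrable (fun z : Phase d × Conf d => ‖symplecticSchwartz h z.1‖ * ‖v z.2‖ ^ 2)
      (volume.prod volume) := hF.norm.mul_prod (integrable_norm_sq v)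
  have h2 : Integrable (fun z : Phase d × Conf d =>
      ‖symplecticSchwartz h z.1‖ * ‖u (z.2 + z.1.1)‖ ^ 2) (volume.prod volume) :=
    measurePreserving_shear.integrable_comp_of_integrable
      (hF.norm.mul_prod (integrable_norm_sq u))
  refine (h1.add h2).mono' ?_ (Filter.Eventually.of_forall fun z => ?_)
  · have h3 : AEStronglyMeasurable (fun z : Phase d × Conf d => u (z.2 + z.1.1))
        (volume.prod volume) :=
      ((Lp.memLp u).aestronglyMeasurable.comp_snd (μ := (volume : Measure (Phase d)))).comp_measurePreserving
        measurePreserving_shear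
    have h4 : AEStronglyMeasurable (fun z : Phase d × Conf d => (starRingEnd ℂ) (v z.2))
        (volume.prod volume) :=
      Complex.continuous_conj.comp_aestronglyMeasurable (Lp.memLp v).aestronglyMeasurable.comp_snd
    have h5 := continuous_weylPhase_uncurry hA
    have h6 : Continuous fun z : Phase d × Conf d => exp (-I * (weylPhase A z.1 z.2 : ℂ)) := by
      fun_prop
    exact ((symplecticSchwartz h).continuous.comp continuous_fst).aestronglyMeasurable.mul
      ((h6.aestronglyMeasurable.mul h3).mul h4)
  · rw [norm_mul, norm_mul, norm_mul, norm_exp_neg_I_mul, one_mul, RCLike.norm_conj,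
      Pi.add_apply, ← mul_add]
    gcongr
    nlinarith [sq_nonneg (‖u (z.2 + z.1.1)‖ - ‖v z.2‖), norm_nonneg (u (z.2 + z.1.1)),
      norm_nonneg (v z.2)]

theorem integral_symplecticSchwartz (h : 𝓢(Phase d, ℂ)) (x m : Conf d) :
    ∫ ξ, symplecticSchwartz h (x, ξ) * exp (-I * (⟪ξ, m⟫ : ℂ))
      = ((2 * Real.pi : ℝ) : ℂ) ^ d * momentumFourier h (m, x) := by
  rw [← momentumFourier_symplecticSchwartz, ← partialFourier_eq_momentumFourier,
    partialFourier_apply]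
  refine integral_congr_ae (Filter.Eventually.of_forall fun ξ => ?_)
  simp only
  rw [mul_comm, real_inner_comm]

/-- The momentum enters the phase through ⟪ξ, q + x/2⟫ only, so the ξ-integral evaluates the
momentum transform of h at the midpoint of q and p = q + x. This is the source of the midpoint in
`weylKernel`. -/
theorem integral_phase_matrixElement (h : 𝓢(Phase d, ℂ)) (u : L2 d) (c : ℂ) (q : Conf d)
    (hint : Integrable (fun X : Phase d => symplecticSchwartz h X *
      (exp (-I * (weylPhase A X q : ℂ)) * u (q + X.1) * c))) :
    ∫ X : Phase d, symplecticSchwartz h X * (exp (-I * (weylPhase A X q : ℂ)) * u (q + X.1) * c)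
      = ((2 * Real.pi : ℝ) : ℂ) ^ d * ((∫ p, weylKernel A h q p * u p) * c) := by
  rw [Measure.volume_eq_prod] at hint ⊢
  rw [integral_prod _ hint]
  have h1 : ∀ x, ∫ ξ, symplecticSchwartz h (x, ξ) *
      (exp (-I * (weylPhase A (x, ξ) q : ℂ)) * u (q + x) * c)
      = ((2 * Real.pi : ℝ) : ℂ) ^ d * ((weylKernel A h q (x + q) * u (x + q)) * c) := by
    intro x
    have h2 : ∀ ξ, symplecticSchwartz h (x, ξ) *
        (exp (-I * (weylPhase A (x, ξ) q : ℂ)) * u (q + x) * c)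
        = symplecticSchwartz h (x, ξ) * exp (-I * (⟪ξ, q + (1 / 2 : ℝ) • x⟫ : ℂ)) *
          (exp (-I * (circulation A q (q + x) : ℂ)) * u (q + x) * c) := by
      intro ξ
      have h3 : exp (-I * (weylPhase A (x, ξ) q : ℂ))
          = exp (-I * (⟪ξ, q + (1 / 2 : ℝ) • x⟫ : ℂ)) *
            exp (-I * (circulation A q (q + x) : ℂ)) := by
        rw [← Complex.exp_add, weylPhase, inner_add_right, inner_smul_right]
        congr 1
        push_cast
        ring
      rw [h3]
      ring
    simp only [h2]
    rw [integral_mul_const, integral_symplecticSchwartz, weylKernel, add_comm x q]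
    have h4 : (1 / 2 : ℝ) • (q + (q + x)) = q + (1 / 2 : ℝ) • x := by module
    rw [h4, add_sub_cancel_left]
    ring
  simp only [h1]
  rw [integral_const_mul, integral_mul_const,
    integral_add_right_eq_self (fun p => weylKernel A h q p * u p) q]

/-- The magnetic Weyl quantization of a Schwartz function is an integral operator. -/
theorem coeFn_magneticOp (hA : ∀ j, (A j).HasTemperateGrowth) (h : 𝓢(Phase d, ℂ)) (u : L2 d) :
    (magneticOp A h u : Conf d → ℂ) =ᵐ[volume] fun q => ∫ p, weylKernel A h q p * u p := by
  have hmem := (isDecayingKernel_weylKernel hA h).memLp_integral u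
  suffices heq : magneticOp A h u = hmem.toLp _ by
    rw [heq]; exact hmem.coeFn_toLp
  -- Pairing with v turns the Bochner integral into a scalar double integral, where Fubini is
  -- available.
  refine ext_inner_left ℂ fun v => ?_
  have hint := integrable_matrixElement hA h u v
  have h1 : ∀ X, inner ℂ v (symplecticSchwartz h X • weylUnitary hA X u)
      = ∫ q, symplecticSchwartz h X *
        (exp (-I * (weylPhase A X q : ℂ)) * u (q + X.1) * (starRingEnd ℂ) (v q)) := by
    intro X
    rw [inner_smul_right, L2.inner_def, ← integral_const_mul]
    refine integral_congr_ae ?_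
    filter_upwards [coeFn_weylUnitary hA X u] with q hq
    rw [hq, RCLike.inner_apply]
  have h2 : inner ℂ v (magneticOp A h u) = ((2 * Real.pi : ℝ) : ℂ)⁻¹ ^ d *
      ∫ X, inner ℂ v (symplecticSchwartz h X • weylUnitary hA X u) := by
    rw [integral_inner (integrable_symplectic_smul_weylUnitary hA h u), ← inner_smul_right]
    simp only [magneticOp, symplecticSchwartz_apply, weylSystem_eq hA]
  rw [h2]
  simp only [h1]
  rw [integral_integral_swap hint, L2.inner_def, inv_pow,
    inv_mul_eq_iff_eq_mul₀ two_pi_pow_ne_zero, ← integral_const_mul]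
  refine integral_congr_ae ?_
  filter_upwards [hint.prod_left_ae, hmem.coeFn_toLp] with q hq hq2
  rw [hq2, RCLike.inner_apply]
  exact integral_phase_matrixElement h u _ q hq

/-- Equal operators have equal kernels; the phase never vanishes, and every (m, x) is the midpoint
and difference of m - x/2 and m + x/2. -/
theorem magneticOp_injective (hA : ∀ j, (A j).HasTemperateGrowth) :
    Function.Injective (magneticOp A) := by
  intro h k hhk
  have hz := ((isDecayingKernel_weylKernel hA h).sub (isDecayingKernel_weylKernel hA k)).eq_zero
    fun u => by
      filter_upwards [coeFn_magneticOp hA h u, coeFn_magneticOp hA k u] with q h1 h2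
      simp only [sub_mul]
      rw [integral_sub ((isDecayingKernel_weylKernel hA h).integrable_mul u q)
        ((isDecayingKernel_weylKernel hA k).integrable_mul u q), ← h1, ← h2, hhk, sub_self]
      rfl
  refine momentumFourier_injective (SchwartzMap.ext ?_)
  rintro ⟨m, x⟩
  have h1 := hz (m - (1 / 2 : ℝ) • x) (m + (1 / 2 : ℝ) • x)
  have e1 : (1 / 2 : ℝ) • (m - (1 / 2 : ℝ) • x + (m + (1 / 2 : ℝ) • x)) = m := by module
  have e2 : m + (1 / 2 : ℝ) • x - (m - (1 / 2 : ℝ) • x) = x := by module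
  rw [weylKernel, weylKernel, e1, e2, ← sub_mul] at h1
  exact sub_eq_zero.1 ((mul_eq_zero.1 h1).resolve_right (Complex.exp_ne_zero _))

theorem magneticOp_comp (hA : ∀ j, (A j).HasTemperateGrowth) {f g h : 𝓢(Phase d, ℂ)}
    (hker : ∀ q r, ∫ p, weylKernel A f q p * weylKernel A g p r = weylKernel A h q r) :
    magneticOp A f ∘ magneticOp A g = magneticOp A h := by
  funext u
  refine Lp.ext ?_
  filter_upwards [coeFn_magneticOp hA f (magneticOp A g u), coeFn_magneticOp hA h u] with q h1 h2
  rw [Function.comp_apply, h1, h2]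
  have h3 : ∫ p, weylKernel A f q p * magneticOp A g u p
      = ∫ p, weylKernel A f q p * ∫ r, weylKernel A g p r * u r := by
    refine integral_congr_ae ?_
    filter_upwards [coeFn_magneticOp hA g u] with p hp
    rw [hp]
  rw [h3, (isDecayingKernel_weylKernel hA f).integral_comp (isDecayingKernel_weylKernel hA g)]
  simp only [hker]

end OperatorKernel

end MagneticWeyl

end

noncomputable section

namespace MagneticWeyl

open scoped ContDiff Topology RealInnerProductSpace

/-! ### The magnetic product and the composition of kernels. -/

section MagneticProduct

variable {d : ℕ} {B : Fin d → Fin d → Conf d → ℝ}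

theorem norm_omega (B : Fin d → Fin d → Conf d → ℝ) (a b c : Conf d) : ‖omega B a b c‖ = 1 :=
  norm_exp_neg_I_mul _

theorem hasTemperateGrowth_omega (hB : ∀ l j, (B l j).HasTemperateGrowth) {E : Type}
    [NormedAddCommGroup E] [NormedSpace ℝ E] {a b c : E → Conf d} (ha : a.HasTemperateGrowth)
    (hb : b.HasTemperateGrowth) (hc : c.HasTemperateGrowth) :
    (fun x => omega B (a x) (b x) (c x)).HasTemperateGrowth :=
  hasTemperateGrowth_expNegI (hasTemperateGrowth_flux hB ha hb hc)

theorem omega_eq_circulation {A : Fin d → Conf d → ℝ} (hA : IsPolVectorPotential B A)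
    (a b c : Conf d) :
    exp (-I * (circulation A a b : ℂ)) * exp (-I * (circulation A b c : ℂ))
      = omega B a b c * exp (-I * (circulation A a c : ℂ)) := by
  rw [omega, flux_eq_circulation hA, ← Complex.exp_add, ← Complex.exp_add]
  congr 1
  push_cast
  ring

/-- The map `((m, w), y) ↦ ((m - (w - y) / 2, y), (m + y / 2, w - y))`. -/
def splitMap : Phase d × Conf d →L[ℝ] Phase d × Phase d :=
  let m := (ContinuousLinearMap.fst ℝ (Conf d) (Conf d)).comp
    (ContinuousLinearMap.fst ℝ (Phase d) (Conf d))
  let w := (ContinuousLinearMap.snd ℝ (Conf d) (Conf d)).comp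
    (ContinuousLinearMap.fst ℝ (Phase d) (Conf d))
  let y := ContinuousLinearMap.snd ℝ (Phase d) (Conf d)
  ((m - (1 / 2 : ℝ) • (w - y)).prod y).prod ((m + (1 / 2 : ℝ) • y).prod (w - y))

theorem splitMap_apply (m w y : Conf d) :
    splitMap ((m, w), y) = ((m - (1 / 2 : ℝ) • (w - y), y), (m + (1 / 2 : ℝ) • y, w - y)) := rfl

theorem splitMap_injective : Function.Injective (splitMap (d := d)) := by
  refine (injective_iff_map_eq_zero _).2 ?_
  rintro ⟨⟨m, w⟩, y⟩ h
  simp only [splitMap_apply, Prod.mk_eq_zero] at h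
  obtain ⟨⟨-, h2⟩, h3, h4⟩ := h
  subst h2
  simp only [smul_zero, add_zero, sub_zero] at h3 h4
  simp [h3, h4]

/-- The phase factor of the composition of two kernels. -/
def splitOmega (B : Fin d → Fin d → Conf d → ℝ) (p : Phase d × Conf d) : ℂ :=
  omega B (p.1.1 - (1 / 2 : ℝ) • p.1.2) (p.1.1 - (1 / 2 : ℝ) • p.1.2 + p.2)
    (p.1.1 + (1 / 2 : ℝ) • p.1.2)

theorem hasTemperateGrowth_splitOmega (hB : ∀ l j, (B l j).HasTemperateGrowth) :
    (splitOmega B).HasTemperateGrowth := by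
  have hm : (fun p : Phase d × Conf d => p.1.1).HasTemperateGrowth :=
    ((ContinuousLinearMap.fst ℝ (Conf d) (Conf d)).comp
      (ContinuousLinearMap.fst ℝ (Phase d) (Conf d))).hasTemperateGrowth
  have hw : (fun p : Phase d × Conf d => (1 / 2 : ℝ) • p.1.2).HasTemperateGrowth :=
    ((1 / 2 : ℝ) • (ContinuousLinearMap.snd ℝ (Conf d) (Conf d)).comp
      (ContinuousLinearMap.fst ℝ (Phase d) (Conf d))).hasTemperateGrowth
  have hy : (fun p : Phase d × Conf d => p.2).HasTemperateGrowth :=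
    (ContinuousLinearMap.snd ℝ (Phase d) (Conf d)).hasTemperateGrowth
  exact hasTemperateGrowth_omega hB (hm.sub hw) ((hm.sub hw).add hy) (hm.add hw)

/-- The integrand of the composition of two kernels, as a Schwartz function. -/
def splitSchwartz (B : Fin d → Fin d → Conf d → ℝ) (f g : 𝓢(Phase d, ℂ)) :
    𝓢(Phase d × Conf d, ℂ) :=
  SchwartzMap.smulLeftCLM ℂ (splitOmega B)
    (compInjective splitMap splitMap_injective (tensor (momentumFourier f) (momentumFourier g)))

theorem splitSchwartz_apply (hB : ∀ l j, (B l j).HasTemperateGrowth) (f g : 𝓢(Phase d, ℂ))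
    (m w y : Conf d) :
    splitSchwartz B f g ((m, w), y)
      = omega B (m - (1 / 2 : ℝ) • w) (m - (1 / 2 : ℝ) • w + y) (m + (1 / 2 : ℝ) • w) *
        (momentumFourier f (m - (1 / 2 : ℝ) • (w - y), y) *
          momentumFourier g (m + (1 / 2 : ℝ) • y, w - y)) := by
  rw [splitSchwartz, SchwartzMap.smulLeftCLM_apply_apply (hasTemperateGrowth_splitOmega hB),
    compInjective_apply, splitMap_apply, tensor_apply, smul_eq_mul, splitOmega]

theorem inl_injective :
    Function.Injective (ContinuousLinearMap.inl ℝ (Phase d) (Conf d)) :=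
  fun _ _ h => congrArg Prod.fst h

/-- The momentum Fourier transform of the magnetic product. -/
def composedKernel (B : Fin d → Fin d → Conf d → ℝ) (f g : 𝓢(Phase d, ℂ)) : 𝓢(Phase d, ℂ) :=
  compInjective (ContinuousLinearMap.inl ℝ (Phase d) (Conf d)) inl_injective
    (partialFourier (splitSchwartz B f g))

/-- Integrating out y is the partial Fourier transform at frequency 0, which is why the result is
Schwartz. -/
theorem composedKernel_apply (B : Fin d → Fin d → Conf d → ℝ) (f g : 𝓢(Phase d, ℂ))
    (p : Phase d) : composedKernel B f g p = ∫ y, splitSchwartz B f g (p, y) := by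
  rw [composedKernel, compInjective_apply, ContinuousLinearMap.inl_apply, partialFourier_apply]
  simp

/-- The magnetic product `f ♯^B g` of two Schwartz functions. -/
def magneticProduct (B : Fin d → Fin d → Conf d → ℝ) (f g : 𝓢(Phase d, ℂ)) : 𝓢(Phase d, ℂ) :=
  momentumFourierInv (composedKernel B f g)

/-- With p = q + y, m = (q + r)/2 and w = r - q, the two midpoints become m - (w - y)/2 and m + y/2,
and Stokes trades the two circulations for ω^B times the phase from q to r. -/
theorem integral_weylKernel_mul (hB : ∀ l j, (B l j).HasTemperateGrowth)
    {A : Fin d → Conf d → ℝ} (hA : IsPolVectorPotential B A) (f g : 𝓢(Phase d, ℂ))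
    (q r : Conf d) :
    ∫ p, weylKernel A f q p * weylKernel A g p r = weylKernel A (magneticProduct B f g) q r := by
  rw [weylKernel, magneticProduct, momentumFourier_momentumFourierInv, composedKernel_apply,
    ← integral_mul_const, ← integral_add_right_eq_self _ q]
  refine integral_congr_ae (Filter.Eventually.of_forall fun y => ?_)
  simp only
  rw [splitSchwartz_apply hB, weylKernel, weylKernel]
  have e1 : (1 / 2 : ℝ) • (q + r) - (1 / 2 : ℝ) • (r - q) = q := by module
  have e2 : (1 / 2 : ℝ) • (q + r) + (1 / 2 : ℝ) • (r - q) = r := by module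
  have e3 : (1 / 2 : ℝ) • (q + r) - (1 / 2 : ℝ) • (r - q - y)
      = (1 / 2 : ℝ) • (q + (y + q)) := by module
  have e4 : (1 / 2 : ℝ) • (q + r) + (1 / 2 : ℝ) • y = (1 / 2 : ℝ) • (y + q + r) := by module
  have e5 : r - q - y = r - (y + q) := by abel
  rw [e1, e2, e3, e4, e5, add_sub_cancel_right, add_comm q y]
  linear_combination (momentumFourier f ((1 / 2 : ℝ) • (q + (y + q)), y) *
    momentumFourier g ((1 / 2 : ℝ) • (y + q + r), r - (y + q))) *
    omega_eq_circulation hA q (y + q) r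

theorem magneticOp_comp_magneticProduct (hB : ∀ l j, (B l j).HasTemperateGrowth)
    {A : Fin d → Conf d → ℝ} (hA : IsPolVectorPotential B A) (f g : 𝓢(Phase d, ℂ)) :
    magneticOp A f ∘ magneticOp A g = magneticOp A (magneticProduct B f g) :=
  magneticOp_comp hA.pol (integral_weylKernel_mul hB hA f g)

end MagneticProduct

/-! ### The two integral formulas for the product. -/

section IntegralFormulas

variable {d : ℕ} {B : Fin d → Fin d → Conf d → ℝ}

theorem integrable_schwartz_comp_affine {E : Type} [NormedAddCommGroup E] [NormedSpace ℝ E]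
    (G : 𝓢(E, ℂ)) (c : E) (L : Phase d →L[ℝ] E) (hL : Function.Injective L) :
    Integrable fun p => G (L p + c) := by
  have h := (compInjective L hL (SchwartzMap.compSubConstCLM ℂ (-c) G)).integrable (μ := volume)
  refine h.congr (Filter.Eventually.of_forall fun p => ?_)
  simp [compInjective_apply]

/-- The integrand, in position variables, of the magnetic product at `(x, ξ)`. -/
def positionIntegrand (B : Fin d → Fin d → Conf d → ℝ) (f g : 𝓢(Phase d, ℂ)) (x ξ y z : Conf d) :
    ℂ :=
  exp (I * (⟪ξ, y + z⟫ : ℂ)) *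
    omega B (x - (1 / 2 : ℝ) • (y + z)) (x + (1 / 2 : ℝ) • (y - z)) (x + (1 / 2 : ℝ) • (y + z)) *
    momentumFourier f (x - (1 / 2 : ℝ) • z, y) * momentumFourier g (x + (1 / 2 : ℝ) • y, z)

theorem positionIntegrand_eq (hB : ∀ l j, (B l j).HasTemperateGrowth) (f g : 𝓢(Phase d, ℂ))
    (x ξ y z : Conf d) : positionIntegrand B f g x ξ y z
      = exp (I * (⟪ξ, z + y⟫ : ℂ)) * splitSchwartz B f g ((x, z + y), y) := by
  rw [splitSchwartz_apply hB, positionIntegrand, add_sub_cancel_right, add_comm z y]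
  have e1 : x - (1 / 2 : ℝ) • (y + z) + y = x + (1 / 2 : ℝ) • (y - z) := by module
  rw [e1]
  ring

theorem norm_exp_I_mul (t : ℝ) : ‖exp (I * (t : ℂ))‖ = 1 := by
  rw [mul_comm, Complex.norm_exp_ofReal_mul_I]

theorem integrable_positionIntegrand (hB : ∀ l j, (B l j).HasTemperateGrowth)
    (f g : 𝓢(Phase d, ℂ)) (x ξ : Conf d) :
    Integrable (fun p : Conf d × Conf d => positionIntegrand B f g x ξ p.1 p.2)
      (volume.prod volume) := by
  have h := integrable_schwartz_comp_affine (splitSchwartz B f g) ((x, 0), 0)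
    (((0 : Phase d →L[ℝ] Conf d).prod (ContinuousLinearMap.snd ℝ (Conf d) (Conf d)
      + ContinuousLinearMap.fst ℝ (Conf d) (Conf d))).prod
        (ContinuousLinearMap.fst ℝ (Conf d) (Conf d)))
    (by
      refine (injective_iff_map_eq_zero _).2 ?_
      rintro ⟨a, b⟩ hab
      simp only [ContinuousLinearMap.prod_apply, Prod.mk_eq_zero, _root_.add_apply,
        ContinuousLinearMap.coe_fst', ContinuousLinearMap.coe_snd'] at hab
      obtain ⟨⟨-, h1⟩, h2⟩ := hab
      subst h2
      simpa using h1)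
  have h' : Integrable (fun p : Conf d × Conf d => splitSchwartz B f g ((x, p.2 + p.1), p.1)) := by
    simpa using h
  rw [Measure.volume_eq_prod] at h'
  simp only [positionIntegrand_eq hB]
  refine h'.norm.mono' ((by fun_prop : Continuous fun p : Conf d × Conf d =>
      exp (I * (⟪ξ, p.2 + p.1⟫ : ℂ))).aestronglyMeasurable.mul h'.aestronglyMeasurable)
    (Filter.Eventually.of_forall fun p => ?_)
  rw [norm_mul, norm_exp_I_mul, one_mul]

/-- The inverse momentum transform integrates over the total displacement w; after Fubini, the
translation w = z + y makes the formula symmetric in the two displacements. -/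
theorem magneticProduct_eq_positionIntegral (hB : ∀ l j, (B l j).HasTemperateGrowth)
    (f g : 𝓢(Phase d, ℂ)) (x ξ : Conf d) :
    magneticProduct B f g (x, ξ) = ∫ y, ∫ z, positionIntegrand B f g x ξ y z := by
  have h := integrable_schwartz_comp_affine (splitSchwartz B f g) ((x, 0), 0)
    (((0 : Phase d →L[ℝ] Conf d).prod (ContinuousLinearMap.fst ℝ (Conf d) (Conf d))).prod
        (ContinuousLinearMap.snd ℝ (Conf d) (Conf d)))
    (by
      refine (injective_iff_map_eq_zero _).2 ?_
      rintro ⟨a, b⟩ hab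
      simpa using hab)
  have h' : Integrable (fun p : Conf d × Conf d => splitSchwartz B f g ((x, p.1), p.2)) := by
    simpa using h
  rw [Measure.volume_eq_prod] at h'
  have hint : Integrable (Function.uncurry fun w y : Conf d =>
      exp (I * (⟪ξ, w⟫ : ℂ)) * splitSchwartz B f g ((x, w), y)) (volume.prod volume) := by
    refine h'.norm.mono' ((by fun_prop : Continuous fun p : Conf d × Conf d =>
      exp (I * (⟪ξ, p.1⟫ : ℂ))).aestronglyMeasurable.mul h'.aestronglyMeasurable)
      (Filter.Eventually.of_forall fun p => ?_)
    rw [Function.uncurry, norm_mul, norm_exp_I_mul, one_mul]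
  rw [magneticProduct, momentumFourierInv_apply]
  simp only [composedKernel_apply, ← integral_const_mul]
  rw [integral_integral_swap hint]
  refine integral_congr_ae (Filter.Eventually.of_forall fun y => ?_)
  simp only [positionIntegrand_eq hB]
  exact (integral_add_right_eq_self
    (fun w => exp (I * (⟪ξ, w⟫ : ℂ)) * splitSchwartz B f g ((x, w), y)) y).symm

section PhaseIntegral

variable (φ ψ : 𝓢(Phase d, ℂ)) (a : Conf d → Conf d → ℂ) (α β : Conf d → Conf d)

/-- An oscillatory integrand on `Ξ × Ξ` whose momentum integrals are partial Fourier transforms. -/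
def phaseIntegrand (Y Z : Phase d) : ℂ :=
  a Y.1 Z.1 * (exp (-I * (⟪α Z.1, Y.2⟫ : ℂ)) * φ Y) * (exp (-I * (⟪β Y.1, Z.2⟫ : ℂ)) * ψ Z)

variable {φ ψ a α β}

theorem continuous_phaseIntegrand (ha : Continuous fun p : Conf d × Conf d => a p.1 p.2)
    (hα : Continuous α) (hβ : Continuous β) :
    Continuous fun p : Phase d × Phase d => phaseIntegrand φ ψ a α β p.1 p.2 := by
  have h1 : Continuous fun p : Phase d × Phase d => a p.1.1 p.2.1 :=
    ha.comp (by fun_prop : Continuous fun p : Phase d × Phase d => (p.1.1, p.2.1))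
  have h2 : Continuous fun p : Phase d × Phase d => φ p.1 := φ.continuous.comp continuous_fst
  have h3 : Continuous fun p : Phase d × Phase d => ψ p.2 := ψ.continuous.comp continuous_snd
  unfold phaseIntegrand
  fun_prop

theorem norm_phaseIntegrand (hn : ∀ y z, ‖a y z‖ = 1) (Y Z : Phase d) :
    ‖phaseIntegrand φ ψ a α β Y Z‖ = ‖φ Y‖ * ‖ψ Z‖ := by
  rw [phaseIntegrand, norm_mul, norm_mul, norm_mul, norm_mul, hn, norm_exp_neg_I_mul,
    norm_exp_neg_I_mul, one_mul, one_mul, one_mul]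

theorem integrable_phaseIntegrand (ha : Continuous fun p : Conf d × Conf d => a p.1 p.2)
    (hn : ∀ y z, ‖a y z‖ = 1) (hα : Continuous α) (hβ : Continuous β) :
    Integrable (fun p : Phase d × Phase d => phaseIntegrand φ ψ a α β p.1 p.2)
      (volume.prod volume) :=
  ((φ.integrable (μ := volume)).norm.mul_prod (ψ.integrable (μ := volume)).norm).mono'
    (continuous_phaseIntegrand ha hα hβ).aestronglyMeasurable
    (Filter.Eventually.of_forall fun p => (norm_phaseIntegrand hn p.1 p.2).le)

theorem integral_phaseIntegrand_right (ha : Continuous fun p : Conf d × Conf d => a p.1 p.2)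
    (hn : ∀ y z, ‖a y z‖ = 1) (hα : Continuous α) (hβ : Continuous β) (y η : Conf d) :
    ∫ Z, phaseIntegrand φ ψ a α β (y, η) Z = ∫ z, a y z *
      (exp (-I * (⟪α z, η⟫ : ℂ)) * φ (y, η)) * partialFourier ψ (z, β y) := by
  have hint : Integrable (fun Z : Phase d => phaseIntegrand φ ψ a α β (y, η) Z)
      (volume.prod volume) :=
    ((ψ.integrable (μ := volume)).norm.const_mul ‖φ (y, η)‖).mono'
      ((continuous_phaseIntegrand ha hα hβ).comp
        (Continuous.prodMk_right (y, η))).aestronglyMeasurable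
      (Filter.Eventually.of_forall fun Z => (norm_phaseIntegrand hn (y, η) Z).le)
  rw [Measure.volume_eq_prod, integral_prod _ hint]
  refine integral_congr_ae (Filter.Eventually.of_forall fun z => ?_)
  simp only [phaseIntegrand]
  rw [integral_const_mul, partialFourier_apply]

/-- The phase couples each momentum only to the position of the other point. Once the order of the
inner momentum of Y and the position of Z is exchanged, both momentum integrals are partial Fourier
transforms. -/
theorem integral_phaseIntegrand (ha : Continuous fun p : Conf d × Conf d => a p.1 p.2)
    (hn : ∀ y z, ‖a y z‖ = 1) (hα : Continuous α) (hβ : Continuous β) :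
    ∫ Y, ∫ Z, phaseIntegrand φ ψ a α β Y Z
      = ∫ y, ∫ z, a y z * partialFourier φ (y, α z) * partialFourier ψ (z, β y) := by
  have h1 := (integrable_phaseIntegrand (φ := φ) (ψ := ψ) ha hn hα hβ).integral_prod_left
  rw [Measure.volume_eq_prod] at h1 ⊢
  rw [integral_prod _ h1]
  refine integral_congr_ae (Filter.Eventually.of_forall fun y => ?_)
  simp only
  have h2 := integral_phaseIntegrand_right (φ := φ) (ψ := ψ) ha hn hα hβ y
  rw [Measure.volume_eq_prod] at h2
  simp only [h2]
  -- The frequency is fixed and the position varies, so the variables are swapped before slicing.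
  have hψ : Integrable fun z => partialFourier ψ (z, β y) :=
    (slice (swapSchwartz (partialFourier ψ)) (β y)).integrable
  have hφ : Integrable fun η => φ (y, η) := (slice φ y).integrable
  have hswap : Integrable (Function.uncurry fun η z : Conf d => a y z *
      (exp (-I * (⟪α z, η⟫ : ℂ)) * φ (y, η)) * partialFourier ψ (z, β y))
      (volume.prod volume) := by
    refine (hφ.norm.mul_prod hψ.norm).mono' (Continuous.aestronglyMeasurable ?_)
      (Filter.Eventually.of_forall fun p => ?_)
    · have c1 : Continuous fun p : Conf d × Conf d => a y p.2 :=
        ha.comp (by fun_prop : Continuous fun p : Conf d × Conf d => (y, p.2))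
      have c2 : Continuous fun p : Conf d × Conf d => φ (y, p.1) :=
        φ.continuous.comp (by fun_prop)
      have c3 : Continuous fun p : Conf d × Conf d => partialFourier ψ (p.2, β y) :=
        (partialFourier ψ).continuous.comp (by fun_prop)
      unfold Function.uncurry
      fun_prop
    · rw [Function.uncurry, norm_mul, norm_mul, norm_mul, hn, norm_exp_neg_I_mul, one_mul, one_mul]
  rw [integral_integral_swap hswap]
  refine integral_congr_ae (Filter.Eventually.of_forall fun z => ?_)
  simp only
  rw [integral_mul_const, integral_const_mul, partialFourier_apply φ]

end PhaseIntegral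

theorem continuous_omega (hB : ∀ l j, (B l j).HasTemperateGrowth) :
    Continuous fun p : Conf d × Conf d × Conf d => omega B p.1 p.2.1 p.2.2 :=
  (hasTemperateGrowth_omega hB
    (ContinuousLinearMap.fst ℝ (Conf d) (Conf d × Conf d)).hasTemperateGrowth
    ((ContinuousLinearMap.fst ℝ (Conf d) (Conf d)).comp
      (ContinuousLinearMap.snd ℝ (Conf d) (Conf d × Conf d))).hasTemperateGrowth
    ((ContinuousLinearMap.snd ℝ (Conf d) (Conf d)).comp
      (ContinuousLinearMap.snd ℝ (Conf d) (Conf d × Conf d))).hasTemperateGrowth).1.continuous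

/-- The position part of the symplectic Fourier form of the product. -/
def fourierAmplitude (B : Fin d → Fin d → Conf d → ℝ) (x ξ y z : Conf d) : ℂ :=
  exp (I * (⟪ξ, y + z⟫ : ℂ)) *
    omega B (x - (1 / 2 : ℝ) • (y + z)) (x + (1 / 2 : ℝ) • (y - z)) (x + (1 / 2 : ℝ) • (y + z))

/-- The position part of the direct form of the product. -/
def directAmplitude (B : Fin d → Fin d → Conf d → ℝ) (x ξ y z : Conf d) : ℂ :=
  exp (I * (⟪ξ, (2 : ℝ) • (z - y)⟫ : ℂ)) * omega B (x + y - z) (-x + y + z) (x - y + z)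

theorem continuous_fourierAmplitude (hB : ∀ l j, (B l j).HasTemperateGrowth) (x ξ : Conf d) :
    Continuous fun p : Conf d × Conf d => fourierAmplitude B x ξ p.1 p.2 := by
  have h := (continuous_omega hB).comp (by fun_prop : Continuous fun p : Conf d × Conf d =>
    (x - (1 / 2 : ℝ) • (p.1 + p.2), x + (1 / 2 : ℝ) • (p.1 - p.2), x + (1 / 2 : ℝ) • (p.1 + p.2)))
  exact (by fun_prop : Continuous fun p : Conf d × Conf d =>
    exp (I * (⟪ξ, p.1 + p.2⟫ : ℂ))).mul h

theorem continuous_directAmplitude (hB : ∀ l j, (B l j).HasTemperateGrowth) (x ξ : Conf d) :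
    Continuous fun p : Conf d × Conf d => directAmplitude B x ξ p.1 p.2 := by
  have h := (continuous_omega hB).comp (by fun_prop : Continuous fun p : Conf d × Conf d =>
    (x + p.1 - p.2, -x + p.1 + p.2, x - p.1 + p.2))
  exact (by fun_prop : Continuous fun p : Conf d × Conf d =>
    exp (I * (⟪ξ, (2 : ℝ) • (p.2 - p.1)⟫ : ℂ))).mul h

theorem norm_fourierAmplitude (x ξ y z : Conf d) : ‖fourierAmplitude B x ξ y z‖ = 1 := by
  rw [fourierAmplitude, norm_mul, norm_exp_I_mul, norm_omega, one_mul]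

theorem norm_directAmplitude (x ξ y z : Conf d) : ‖directAmplitude B x ξ y z‖ = 1 := by
  rw [directAmplitude, norm_mul, norm_exp_I_mul, norm_omega, one_mul]

theorem fourierIntegrand_eq (f g : 𝓢(Phase d, ℂ)) (x ξ : Conf d) (Y Z : Phase d) :
    fourierIntegrand B f g (x, ξ) Y Z = phaseIntegrand (symplecticSchwartz f)
      (symplecticSchwartz g) (fourierAmplitude B x ξ) (fun z => x - (1 / 2 : ℝ) • z)
      (fun y => x + (1 / 2 : ℝ) • y) Y Z := by
  rw [fourierIntegrand, phaseIntegrand, fourierAmplitude, symplecticSchwartz_apply,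
    symplecticSchwartz_apply]
  have h : exp (I * (sigma (x, ξ) (Y + Z) : ℂ)) * exp (I / 2 * (sigma Y Z : ℂ))
      = exp (I * (⟪ξ, Y.1 + Z.1⟫ : ℂ)) * exp (-I * (⟪x - (1 / 2 : ℝ) • Z.1, Y.2⟫ : ℂ)) *
        exp (-I * (⟪x + (1 / 2 : ℝ) • Y.1, Z.2⟫ : ℂ)) := by
    simp only [← Complex.exp_add, sigma, Prod.fst_add, Prod.snd_add, inner_add_left,
      inner_add_right, inner_sub_left, inner_smul_left, conj_trivial]
    rw [real_inner_comm Z.1 Y.2]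
    congr 1
    push_cast
    ring
  rw [h]
  ring

theorem directIntegrand_eq (f g : 𝓢(Phase d, ℂ)) (x ξ : Conf d) (Y Z : Phase d) :
    directIntegrand B f g (x, ξ) Y Z = phaseIntegrand f g (directAmplitude B x ξ)
      (fun z => (2 : ℝ) • (z - x)) (fun y => (2 : ℝ) • (x - y)) Y Z := by
  rw [directIntegrand, phaseIntegrand, directAmplitude]
  have h : exp (-(2 * I) * (sigma (Y - (x, ξ)) (Z - (x, ξ)) : ℂ))
      = exp (I * (⟪ξ, (2 : ℝ) • (Z.1 - Y.1)⟫ : ℂ)) *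
        exp (-I * (⟪(2 : ℝ) • (Z.1 - x), Y.2⟫ : ℂ)) *
        exp (-I * (⟪(2 : ℝ) • (x - Y.1), Z.2⟫ : ℂ)) := by
    simp only [← Complex.exp_add, sigma, Prod.fst_sub, Prod.snd_sub, inner_sub_left,
      inner_sub_right, inner_smul_left, inner_smul_right, conj_trivial]
    rw [real_inner_comm Z.1 Y.2, real_inner_comm x Y.2, real_inner_comm x ξ,
      real_inner_comm Y.1 ξ]
    congr 1
    push_cast
    ring
  rw [h]
  ring

theorem integrable_fourierIntegrand (hB : ∀ l j, (B l j).HasTemperateGrowth)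
    (f g : 𝓢(Phase d, ℂ)) (X : Phase d) :
    Integrable (fun p : Phase d × Phase d => fourierIntegrand B f g X p.1 p.2) := by
  simp only [fourierIntegrand_eq f g X.1 X.2]
  exact integrable_phaseIntegrand (continuous_fourierAmplitude hB X.1 X.2)
    (norm_fourierAmplitude X.1 X.2) (by fun_prop) (by fun_prop)

theorem integrable_directIntegrand (hB : ∀ l j, (B l j).HasTemperateGrowth)
    (f g : 𝓢(Phase d, ℂ)) (X : Phase d) :
    Integrable (fun p : Phase d × Phase d => directIntegrand B f g X p.1 p.2) := by
  simp only [directIntegrand_eq f g X.1 X.2]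
  exact integrable_phaseIntegrand (continuous_directAmplitude hB X.1 X.2)
    (norm_directAmplitude X.1 X.2) (by fun_prop) (by fun_prop)

/-- The symplectic transform exchanges the two arguments of the momentum transform, so each partial
transform is (2π)^d times exactly the factor in `positionIntegrand`. -/
theorem integral_fourierIntegrand (hB : ∀ l j, (B l j).HasTemperateGrowth)
    (f g : 𝓢(Phase d, ℂ)) (X : Phase d) :
    ∫ Y, ∫ Z, fourierIntegrand B f g X Y Z
      = ((2 * Real.pi : ℝ) : ℂ) ^ (2 * d) * magneticProduct B f g X := by
  obtain ⟨x, ξ⟩ := X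
  simp only [fourierIntegrand_eq]
  rw [integral_phaseIntegrand (continuous_fourierAmplitude hB x ξ) (norm_fourierAmplitude x ξ)
    (by fun_prop) (by fun_prop), magneticProduct_eq_positionIntegral hB, ← integral_const_mul]
  refine integral_congr_ae (Filter.Eventually.of_forall fun y => ?_)
  simp only
  rw [← integral_const_mul]
  refine integral_congr_ae (Filter.Eventually.of_forall fun z => ?_)
  simp only [partialFourier_eq_momentumFourier, momentumFourier_symplecticSchwartz,
    fourierAmplitude, positionIntegrand]
  ring

theorem integral_comp_two_smul (φ : Conf d → ℂ) :
    ∫ z, φ ((2 : ℝ) • z) = ((2 : ℂ) ^ d)⁻¹ * ∫ z, φ z := by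
  rw [Measure.integral_comp_smul, finrank_euclideanSpace_fin, abs_of_nonneg (by positivity),
    Complex.real_smul]
  push_cast
  rfl

theorem integral_directIntegrand (hB : ∀ l j, (B l j).HasTemperateGrowth)
    (f g : 𝓢(Phase d, ℂ)) (X : Phase d) :
    ∫ Y, ∫ Z, directIntegrand B f g X Y Z
      = (Real.pi : ℂ) ^ (2 * d) * magneticProduct B f g X := by
  obtain ⟨x, ξ⟩ := X
  simp only [directIntegrand_eq]
  rw [integral_phaseIntegrand (continuous_directAmplitude hB x ξ) (norm_directAmplitude x ξ)
    (by fun_prop) (by fun_prop), magneticProduct_eq_positionIntegral hB]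
  -- The displacements are 2(z - x) and 2(x - y): with them the midpoints x - (x - y) and x + (z -
  -- x) become y and z.
  have h1 : ∀ y z, directAmplitude B x ξ y z * partialFourier f (y, (2 : ℝ) • (z - x)) *
      partialFourier g (z, (2 : ℝ) • (x - y))
      = ((2 * Real.pi : ℝ) : ℂ) ^ (2 * d) *
        positionIntegrand B f g x ξ ((2 : ℝ) • (z - x)) ((2 : ℝ) • (x - y)) := by
    intro y z
    simp only [partialFourier_eq_momentumFourier, directAmplitude, positionIntegrand]
    have e1 : (2 : ℝ) • (z - x) + (2 : ℝ) • (x - y) = (2 : ℝ) • (z - y) := by module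
    have e2 : x - (1 / 2 : ℝ) • (2 : ℝ) • (z - y) = x + y - z := by module
    have e3 : x + (1 / 2 : ℝ) • ((2 : ℝ) • (z - x) - (2 : ℝ) • (x - y)) = -x + y + z := by module
    have e4 : x + (1 / 2 : ℝ) • (2 : ℝ) • (z - y) = x - y + z := by module
    have e5 : x - (1 / 2 : ℝ) • (2 : ℝ) • (x - y) = y := by module
    have e6 : x + (1 / 2 : ℝ) • (2 : ℝ) • (z - x) = z := by module
    rw [e1, e2, e3, e4, e5, e6]
    ring
  simp only [h1, integral_const_mul]
  have h2 : ∀ y, ∫ z, positionIntegrand B f g x ξ ((2 : ℝ) • (z - x)) ((2 : ℝ) • (x - y))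
      = ((2 : ℂ) ^ d)⁻¹ * ∫ z, positionIntegrand B f g x ξ z ((2 : ℝ) • (x - y)) := by
    intro y
    rw [integral_sub_right_eq_self
      (fun z => positionIntegrand B f g x ξ ((2 : ℝ) • z) ((2 : ℝ) • (x - y))) x,
      integral_comp_two_smul fun z => positionIntegrand B f g x ξ z ((2 : ℝ) • (x - y))]
  simp only [h2, integral_const_mul]
  -- Each dilation by 2 costs 2^{-d}, so (2π)^{2d} becomes π^{2d}. The first displacement came from
  -- z and the second from y, hence the final exchange of integrals.
  rw [integral_sub_left_eq_self
      (fun y => ∫ z, positionIntegrand B f g x ξ z ((2 : ℝ) • y)) volume x,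
    integral_comp_two_smul fun y => ∫ z, positionIntegrand B f g x ξ z y,
    ← integral_integral_swap (f := fun y z => positionIntegrand B f g x ξ y z)
      (integrable_positionIntegrand hB f g x ξ)]
  have h3 : (2 : ℂ) ^ d ≠ 0 := pow_ne_zero _ two_ne_zero
  push_cast
  rw [mul_pow, pow_mul (2 : ℂ), pow_right_comm, sq]
  field_simp

end IntegralFormulas

end MagneticWeyl

end

open MagneticWeyl in
theorem mainTheorem1 {d : ℕ} (B : Fin d → Fin d → Conf d → ℝ) (hB : IsPolMagneticField B)
    (f g : 𝓢(Phase d, ℂ)) :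
    (∃ A, IsPolVectorPotential B A) ∧
    ∃ h : 𝓢(Phase d, ℂ),
      (∀ A, IsPolVectorPotential B A → ∀ k : 𝓢(Phase d, ℂ),
        (magneticOp A f ∘ magneticOp A g = magneticOp A k ↔ k = h)) ∧
      ∀ X : Phase d,
        Integrable (fun p : Phase d × Phase d => fourierIntegrand B f g X p.1 p.2) ∧
        h X = (((2 * Real.pi) ^ (2 * d) : ℝ) : ℂ)⁻¹ *
          ∫ Y : Phase d, ∫ Z : Phase d, fourierIntegrand B f g X Y Z ∧
        Integrable (fun p : Phase d × Phase d => directIntegrand B f g X p.1 p.2) ∧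
        h X = ((Real.pi ^ (2 * d) : ℝ) : ℂ)⁻¹ *
          ∫ Y : Phase d, ∫ Z : Phase d, directIntegrand B f g X Y Z := by
  refine ⟨exists_isPolVectorPotential hB, magneticProduct B f g, fun A hA k => ?_, fun X => ?_⟩
  -- The composition is already a quantization, so the equivalence is injectivity of `magneticOp`.
  · rw [magneticOp_comp_magneticProduct hB.pol hA f g]
    exact ⟨fun h => (magneticOp_injective hA.pol h).symm, fun h => by rw [h]⟩
  · refine ⟨integrable_fourierIntegrand hB.pol f g X, ?_,
      integrable_directIntegrand hB.pol f g X, ?_⟩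
    · rw [integral_fourierIntegrand hB.pol, ofReal_pow,
        inv_mul_cancel_left₀ two_pi_pow_ne_zero]
    · have hpi : (Real.pi : ℂ) ^ (2 * d) ≠ 0 :=
        pow_ne_zero _ (by exact_mod_cast Real.pi_ne_zero)
      rw [integral_directIntegrand hB.pol, ofReal_pow, inv_mul_cancel_left₀ hpi]
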